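/- **Lemma 2 (Bucket ORP).** Let $n, Z$ be positive integers with $Z\le 2n$, let $B$ be the smallest power of two with $B\ge 2n/Z$, and let $\epsilon(n,Z)=\frac{2n}{Z}\cdot\log_2\!\left(\frac{2n}{Z}\right)\cdot e^{-Z/6}$. *Bucket ORP* is the following algorithm of a client working on an external memory. Each of the $n$ elements of the input array $X$ gets an independent uniformly random key in $\{0,\dots,B-1\}$. The array is divided evenly into $B$ groups of consecutive elements, and the $j$-th group is written, padded with dummies, into the bucket $A^{(0)}_j$ of size $Z$. For $i=0,\dots,\log_2 B-1$ and $j=0,\dots,B/2-1$, with $j'=\lfloor j/2^i\rfloor 2^i$, the client reads $A^{(i)}_{j'+j}$ and $A^{(i)}_{j'+j+2^i}$, and writes those of their real elements whose key has $(i+1)$-st most significant bit $0$ (respectively $1$) to $A^{(i+1)}_{2j}$ (respectively $A^{(i+1)}_{2j+1}$), padded with dummies to size $Z$; if one of these two buckets would receive more than $Z$ elements, the whole execution aborts. Finally, for each bucket $A^{(\log_2 B)}_j$ in turn, the client reads it, deletes the dummies, permutes the remaining elements uniformly at random in its local storage, and appends them to the output array. The access pattern is the sequence of the read and write instructions with the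 addresses accessed. (a) Bucket ORP obliviously implements the random-permutation functionality $X\mapsto X\circ\pi$ ($\pi$ a uniformly random permutation of the $n$ positions) except with probability $\epsilon(n,Z)$: there is a simulator $\mathsf{Sim}$, depending only on $n$ and $Z$, such that for every input array $X$ of length $n$ and every computationally unbounded adversary $\mathcal A$, the probabilities that $\mathcal A$ outputs $1$ on $(\mathsf{Sim},\,X\circ\pi)$, with $\mathsf{Sim}$ and $\pi$ independent, and on the joint access pattern and output of Bucket ORP on $X$ differ by at most $\epsilon(n,Z)$ (an aborted execution has output $\bot$). The simulator can be taken to compute the access pattern deterministically from the vector of loads $(k_0,\dots,k_{B-1})$ obtained by throwing $n$ elements independently and uniformly into $B$ bins. (b) Throw $n$ elements independently and uniformly into $B$ bins of unbounded capacity, permute each bin independently and uniformly, and concatenate the bins. Conditioned on any load vector $\vec k$ of positive probability, each of the $n!$ resulting permutations has probability $1/n!$. (c) Every $\vec k\in\mathbb N^B$ with $\sum_i k_i=n$ has positive probability as a load vector. The number of assignments of the $n$ elements to the $B$ bins with loads $\vec k$ is $\binom{n}{k_0,\dots,k_{B-1}}$, and $\binom{n}{k_0,\dots,k_{B-1}}\cdot\prod_i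 k_i!=n!$. -/

import Mathlib

open scoped Nat

namespace BucketORP

/-! ### Randomized programs over an external memory -/

/-- A randomized client program working on an external memory with address space `Addr` and memory
words in `W`. Reads and writes are visible to the server; coin tosses and computations on values
held by the client are not. `abort` stops the whole execution without an output. -/
inductive Prog (Addr W β : Type) : Type 1
  | ret (b : β) : Prog Addr W β
  | read (a : Addr) (next : W → Prog Addr W β) : Prog Addr W β
  | write (a : Addr) (w : W) (next : Prog Addr W β) : Prog Addr W β
  | rand (γ : Type) [Fintype γ] [Nonempty γ] (next : γ → Prog Addr W β) : Prog Addr W β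
  | abort : Prog Addr W β

/-- One entry of an access pattern: the kind of the instruction and the address accessed. -/
inductive Access (Addr : Type)
  | read (a : Addr)
  | write (a : Addr)

namespace Prog

variable {Addr W β γ : Type}

/-- Sequential composition. -/
def bind : Prog Addr W β → (β → Prog Addr W γ) → Prog Addr W γ
  | ret b, f => f b
  | read a next, f => read a fun w => (next w).bind f
  | write a w next, f => write a w (next.bind f)
  | rand δ next, f => rand δ fun c => (next c).bind f
  | abort, _ => abort

instance : Monad (Prog Addr W) where
  pure := ret
  bind := bind

/-- Read one memory word. -/
def get (a : Addr) : Prog Addr W W := read a ret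

/-- Write one memory word. -/
def put (a : Addr) (w : W) : Prog Addr W Unit := write a w (ret ())

/-- Draw a uniformly random element of a finite nonempty type. -/
def sample (γ : Type) [Fintype γ] [Nonempty γ] : Prog Addr W γ := rand γ ret

/-- `for i = 0, …, m - 1 do f i`. -/
def forRange : ℕ → (ℕ → Prog Addr W Unit) → Prog Addr W Unit
  | 0, _ => pure ()
  | m + 1, f => do
    forRange m f
    f m

/-- Perform `f 0, …, f (m - 1)` in this order and return the list of the results. -/
def collect : ℕ → (ℕ → Prog Addr W β) → Prog Addr W (List β)
  | 0, _ => pure []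
  | m + 1, f => do
    let l ← collect m f
    let b ← f m
    pure (l ++ [b])

/-- The joint distribution of the access pattern and of the result of an execution started in the
memory `mem`. The result is `none` if the execution aborts; otherwise it is the returned value with
the final memory. -/
noncomputable def run [DecidableEq Addr] :
    Prog Addr W β → (Addr → W) → PMF (List (Access Addr) × Option (β × (Addr → W)))
  | ret b, mem => PMF.pure ([], some (b, mem))
  | read a next, mem =>
      ((next (mem a)).run mem).map fun r => (Access.read a :: r.1, r.2)
  | write a w next, mem =>
      (next.run (Function.update mem a w)).map fun r => (Access.write a :: r.1, r.2)
  | rand δ next, mem => (PMF.uniformOfFintype δ).bind fun c => (next c).run mem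
  | abort, _ => PMF.pure ([], none)

end Prog

/-! ### Statistical closeness and oblivious implementation -/

/-- No computationally unbounded (randomized) adversary tells the distributions `p` and `q` apart
with advantage greater than `ε`. -/
def StatIndist {Ω : Type} (ε : ℝ) (p q : PMF Ω) : Prop :=
  ∀ adv : Ω → PMF Bool, |((p.bind adv) true).toReal - ((q.bind adv) true).toReal| ≤ ε

/-- The program `M`, on inputs loaded into the memory by `load` and with outputs extracted from the
final memory by `output`, implements the randomized functionality `f` with `ε`-obliviousness, the
access pattern being simulated by `sim`, which does not see the input: for every input `x` the pair
of independent samples of `sim` and `f x` is `ε`-indistinguishable from the joint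
access pattern and output of `M` on `x`. -/
def ObliviouslyImplements {Addr W I O : Type} [DecidableEq Addr] (M : Prog Addr W Unit)
    (load : I → Addr → W) (output : (Addr → W) → O) (f : I → PMF O)
    (sim : PMF (List (Access Addr))) (ε : ℝ) : Prop :=
  ∀ x : I,
    StatIndist ε
      (sim.bind fun t => (f x).map fun y => (t, some y))
      ((M.run (load x)).map fun r => (r.1, r.2.map fun s => output s.2))

/-! ### Bucket oblivious random permutation -/

/-- A memory word: a dummy, an element, or an element together with its key. -/
inductive Block (α : Type)
  | dummy : Block α
  | elem (a : α) : Block α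
  | keyed (key : ℕ) (a : α) : Block α

namespace Block

variable {α : Type}

/-- Attach a key to an element. -/
def withKey (key : ℕ) : Block α → Block α
  | elem a => keyed key a
  | w => w

/-- Remove the key of an element. -/
def dropKey : Block α → Block α
  | keyed _ a => elem a
  | w => w

/-- Is the word an element with a key, rather than a dummy? -/
def isReal : Block α → Bool
  | keyed _ _ => true
  | _ => false

/-- Bit number `i` (the least significant bit has number `0`) of the key. -/
def keyBit (i : ℕ) : Block α → Bool
  | keyed key _ => key.testBit i
  | _ => false

end Block

/-- The addresses: the cells of the input array, the slots `s` of the bucket `j` of the array of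
level `i`, and the cells of the output array. -/
inductive Addr
  | input (t : ℕ)
  | slot (i j s : ℕ)
  | output (t : ℕ)
  deriving DecidableEq

/-- `log B`, where `B` is the smallest power of two with `B ≥ 2n/Z`. -/
def levels (n Z : ℕ) : ℕ := Nat.clog 2 ((2 * n) ⌈/⌉ Z)

/-- The number `B` of buckets: the smallest power of two with `B ≥ 2n/Z`. -/
abbrev numBuckets (n Z : ℕ) : ℕ := 2 ^ levels n Z

section Algorithm

variable {α : Type}

/-- Read the `Z` slots of bucket `j` of level `i`. -/
def readBucket (Z i j : ℕ) : Prog Addr (Block α) (List (Block α)) :=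
  Prog.collect Z fun s => Prog.get (Addr.slot i j s)

/-- Write `l` into bucket `j` of level `i`, padded with dummies to size `Z`. -/
def writeBucket (Z i j : ℕ) (l : List (Block α)) : Prog Addr (Block α) Unit :=
  Prog.forRange Z fun s => Prog.put (Addr.slot i j s) (l.getD s Block.dummy)

/-- The input is divided evenly into `B` groups of consecutive elements; group `j` consists of the
positions `t` with `⌊jn/B⌋ ≤ t < ⌊(j+1)n/B⌋`. -/
def groupStart (n Z j : ℕ) : ℕ := j * n / numBuckets n Z

/-- Give every element a uniformly random key in `{0, …, B - 1}` and put the groups, padded with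
dummies, into the buckets of level `0`. -/
def initBuckets (n Z : ℕ) : Prog Addr (Block α) Unit :=
  Prog.forRange (numBuckets n Z) fun j =>
    Prog.forRange Z fun s =>
      let t := groupStart n Z j + s
      if t < groupStart n Z (j + 1) then do
        let w ← Prog.get (Addr.input t)
        let key ← Prog.sample (Fin (numBuckets n Z))
        Prog.put (Addr.slot 0 j s) (w.withKey key)
      else
        Prog.put (Addr.slot 0 j s) Block.dummy

/-- The `j`-th call of MergeSplit at level `i`: the buckets `j' + j` and `j' + j + 2^i` of level `i`,
where `j' = ⌊j / 2^i⌋ * 2^i`, are distributed to the buckets `2j` and `2j + 1` of level `i + 1`,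
according to the `(i+1)`-st most significant of the `log B` bits of the keys. -/
def mergeSplit (n Z i j : ℕ) : Prog Addr (Block α) Unit := do
  let j' := j / 2 ^ i * 2 ^ i
  let w₀ ← readBucket Z i (j' + j)
  let w₁ ← readBucket Z i (j' + j + 2 ^ i)
  let real := (w₀ ++ w₁).filter fun w => w.isReal
  let r₀ := real.filter fun w => !w.keyBit (levels n Z - 1 - i)
  let r₁ := real.filter fun w => w.keyBit (levels n Z - 1 - i)
  if Z < r₀.length ∨ Z < r₁.length then
    Prog.abort
  else do
    writeBucket Z (i + 1) (2 * j) r₀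
    writeBucket Z (i + 1) (2 * j + 1) r₁

/-- Oblivious random bin assignment. -/
def binAssignment (n Z : ℕ) : Prog Addr (Block α) Unit := do
  initBuckets n Z
  Prog.forRange (levels n Z) fun i =>
    Prog.forRange (numBuckets n Z / 2) fun j =>
      mergeSplit n Z i j

/-- For each of the first `m` bins of the last level: read the bin, delete the dummies, permute
the remaining elements uniformly at random in the client's storage, and append them (without
keys) to the output array. Returns the number of elements written. -/
def permuteBins (n Z : ℕ) : ℕ → Prog Addr (Block α) ℕ
  | 0 => pure 0
  | m + 1 => do
    let off ← permuteBins n Z m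
    let w ← readBucket Z (levels n Z) m
    let real := w.filter fun w => w.isReal
    let σ ← Prog.sample (Equiv.Perm (Fin real.length))
    let shuffled := List.ofFn fun s => (real.get (σ s)).dropKey
    Prog.forRange real.length fun s =>
      Prog.put (Addr.output (off + s)) (shuffled.getD s Block.dummy)
    pure (off + real.length)

/-- Bucket ORP for `n` elements with buckets of size `Z`. -/
def bucketORP (n Z : ℕ) : Prog Addr (Block α) Unit := do
  binAssignment n Z
  let _ ← permuteBins n Z (numBuckets n Z)
  pure ()

/-- The initial memory: the input array, and dummies elsewhere. -/
def loadInput (n : ℕ) (X : Fin n → α) : Addr → Block α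
  | Addr.input t => if h : t < n then Block.elem (X ⟨t, h⟩) else Block.dummy
  | _ => Block.dummy

/-- The output array in the final memory. -/
def readOutput (n : ℕ) (mem : Addr → Block α) : Fin n → Block α :=
  fun t => mem (Addr.output t)

/-- The permutation functionality: the array `X ∘ π` for a uniformly random permutation `π`. -/
noncomputable def permFunctionality (n : ℕ) (X : Fin n → α) : PMF (Fin n → Block α) :=
  (PMF.uniformOfFintype (Equiv.Perm (Fin n))).map fun π t => Block.elem (X (π t))

end Algorithm

/-- `ε(n, Z) = (2n/Z) · log₂(2n/Z) · e^{-Z/6}`. -/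
noncomputable def errorBound (n Z : ℕ) : ℝ :=
  2 * n / Z * Real.logb 2 (2 * n / Z) * Real.exp (-(Z : ℝ) / 6)

/-! ### Throwing elements into bins -/

/-- The elements in bin `b`, when element `t` is thrown into bin `key t`. -/
def bin {n B : ℕ} (key : Fin n → Fin B) (b : Fin B) : List (Fin n) :=
  (List.finRange n).filter fun t => key t = b

/-- The vector of bin loads. -/
def loads {n B : ℕ} (key : Fin n → Fin B) : Fin B → ℕ := fun b => (bin key b).length

/-- The loads of `B` bins into which `n` elements are thrown independently and uniformly. -/
noncomputable def randomLoads (n B : ℕ) [NeZero B] : PMF (Fin B → ℕ) :=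
  (PMF.uniformOfFintype (Fin n → Fin B)).map loads

/-- Throw `n` elements independently and uniformly into `B` bins of unbounded capacity, permute each
bin independently and uniformly, and concatenate the bins: the joint distribution of
the load vector and of the resulting arrangement of the `n` elements. -/
noncomputable def binShuffle (n B : ℕ) [NeZero B] : PMF ((Fin B → ℕ) × List (Fin n)) :=
  (PMF.uniformOfFintype (Fin n → Fin B)).bind fun key =>
    (PMF.uniformOfFintype ((b : Fin B) → Equiv.Perm (Fin (bin key b).length))).map fun σ =>
      (loads key,
        (List.finRange B).flatMap fun b => List.ofFn fun s => (bin key b).get (σ b s))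

end BucketORP

/-! The keys are independent of everything else, so they may be drawn before the execution starts
(`derandomizes_bucketORP`). Fix keys for which no bucket overflows. The butterfly network then
delivers to final bucket `p` exactly the elements with key `p` (`levelList_perm_binNat`). Up to that
point the access pattern is a fixed sequence; afterwards it depends only on the bin loads, which
determine the offsets and lengths of the output writes. The output is the concatenation of the
independently shuffled bins (`run_bucketORPWithKeys`).

The ideal experiment is a mixture of the same laws over all keys (`ideal_eq`). Relabelling the
elements by a permutation `τ` preserves the law of the keys and their loads, and composes the
arrangement produced by the bins with `τ`. Averaging over `τ` shows that this arrangement is uniform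
and independent of the loads (`binShuffle_eq_uniform`). This also yields the conditional uniformity,
while the number of assignments with given loads comes from orbit-stabilizer (`card_loads_mul`).
Real and ideal experiments thus agree except at overflowing keys, and any advantage is at most the
overflow probability (`statIndist_of_agree`).

A bucket of level `i + 1` is fed by at most `2^i * Z` positions, each with probability `2^(-(i+1))`,
so its mean load is at most `Z / 2`. An exponential moment bounds its overflow probability by
`e^(Z/2) / 2^(Z+1)`. Level 1 cannot overflow, and a union bound over the other levels gives
`errorBound`, using `log 2 > 2/3`. -/

namespace BucketORP

/-! ### Uniform distributions -/

section Uniform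

variable {A B C : Type} [Fintype A] [Nonempty A] [Fintype B] [Nonempty B]

theorem uniform_map_equiv (e : A ≃ B) :
    (PMF.uniformOfFintype A).map e = PMF.uniformOfFintype B := by
  classical
  ext b
  rw [PMF.map_apply, tsum_eq_single (e.symm b)]
  · simp [Fintype.card_congr e]
  · intro a ha
    rw [if_neg]
    rintro rfl
    simp at ha

theorem uniform_bind_equiv (e : A ≃ B) (F : B → PMF C) :
    (PMF.uniformOfFintype A).bind (fun a => F (e a)) = (PMF.uniformOfFintype B).bind F := by
  rw [← uniform_map_equiv e, PMF.bind_map]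
  rfl

theorem uniform_prod_bind (F : A × B → PMF C) :
    (PMF.uniformOfFintype (A × B)).bind F =
      (PMF.uniformOfFintype A).bind fun a => (PMF.uniformOfFintype B).bind fun b => F (a, b) := by
  ext c
  simp only [PMF.bind_apply, PMF.uniformOfFintype_apply, tsum_fintype, Fintype.card_prod,
    Fintype.sum_prod_type, Finset.mul_sum]
  refine Finset.sum_congr rfl fun a _ => Finset.sum_congr rfl fun b _ => ?_
  rw [← mul_assoc, Nat.cast_mul, ENNReal.mul_inv (by simp) (by simp)]

variable {ι κ : Type} [Fintype ι] [DecidableEq ι] [Fintype κ] [Nonempty κ]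

/-- Exchanging the coordinates outside `S` between two functions. -/
def swapOutside (κ : Type) (S : Set ι) [DecidablePred (· ∈ S)] :
    ((ι → κ) × (ι → κ)) ≃ ((ι → κ) × (ι → κ)) :=
  Function.Involutive.toPerm
    (fun p => (fun i => if i ∈ S then p.1 i else p.2 i, fun i => if i ∈ S then p.2 i else p.1 i))
    (fun p => by ext i <;> by_cases h : i ∈ S <;> simp [h])

/-- A function that depends on disjoint sets of coordinates of two independent uniform functions
does not distinguish them from two copies of one uniform function. -/
theorem uniform_bind_diagonal (S : Set ι) (G : (ι → κ) → (ι → κ) → PMF C)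
    (h₁ : ∀ k k' l, (∀ i ∈ S, k i = k' i) → G k l = G k' l)
    (h₂ : ∀ k l l', (∀ i ∉ S, l i = l' i) → G k l = G k l') :
    ((PMF.uniformOfFintype (ι → κ)).bind fun k =>
      (PMF.uniformOfFintype (ι → κ)).bind fun l => G k l) =
    (PMF.uniformOfFintype (ι → κ)).bind fun k => G k k := by
  classical
  rw [← uniform_prod_bind (fun p => G p.1 p.2)]
  have : ∀ p : (ι → κ) × (ι → κ), G p.1 p.2 =
      (fun q : (ι → κ) × (ι → κ) => G q.1 q.1) (swapOutside κ S p) := by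
    intro p
    -- Each argument may be altered on the coordinates that `G` ignores. After the swap both
    -- arguments are the same function.
    rw [h₁ p.1 (fun i => if i ∈ S then p.1 i else p.2 i) _ fun i hi => by simp [hi],
      h₂ _ p.2 (fun i => if i ∈ S then p.1 i else p.2 i) fun i hi => by simp [hi]]
    rfl
  simp_rw [this]
  rw [uniform_bind_equiv (swapOutside κ S) (fun q => G q.1 q.1), uniform_prod_bind]
  simp

theorem uniform_bind_eval (i : ι) (F : κ → PMF C) :
    ((PMF.uniformOfFintype (ι → κ)).bind fun k => F (k i)) =
      (PMF.uniformOfFintype κ).bind F := by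
  have := uniform_prod_bind (A := κ) (B := {j // j ≠ i} → κ) fun p => F p.1
  simp only [PMF.bind_const] at this
  rw [← this, ← uniform_bind_equiv (Equiv.funSplitAt i κ) (fun p => F p.1)]
  rfl

/-- Mixtures of families of distributions that agree off a set of small measure are close. -/
theorem statIndist_of_agree (P Q : A → PMF C) (bad : Finset A) {ε : ℝ}
    (h : ∀ a ∉ bad, P a = Q a) (hε : (bad.card : ℝ) / Fintype.card A ≤ ε) :
    StatIndist ε ((PMF.uniformOfFintype A).bind P) ((PMF.uniformOfFintype A).bind Q) := by
  intro adv
  have key : ∀ R : A → PMF C, ((((PMF.uniformOfFintype A).bind R).bind adv) true).toReal =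
      ∑ a, (Fintype.card A : ℝ)⁻¹ * (((R a).bind adv) true).toReal := by
    intro R
    rw [PMF.bind_bind, PMF.bind_apply, tsum_fintype, ENNReal.toReal_sum]
    · simp
    · intro a _
      exact ENNReal.mul_ne_top (PMF.apply_ne_top _ _) (PMF.apply_ne_top _ _)
  rw [key, key, ← Finset.sum_sub_distrib]
  refine le_trans (Finset.abs_sum_le_sum_abs _ _) (le_trans ?_ hε)
  rw [← Finset.sum_subset (Finset.subset_univ bad)]
  · rw [div_eq_mul_inv, ← nsmul_eq_mul]
    refine Finset.sum_le_card_nsmul _ _ _ fun a _ => ?_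
    rw [← mul_sub, abs_mul, abs_of_nonneg (by positivity)]
    refine mul_le_of_le_one_right (by positivity) ?_
    have one : ∀ R : A → PMF C, (((R a).bind adv) true).toReal ≤ 1 := fun R =>
      ENNReal.toReal_le_of_le_ofReal zero_le_one (by rw [ENNReal.ofReal_one]; exact PMF.coe_le_one _ _)
    rw [abs_le]
    have hp := one P
    have hq := one Q
    have hp0 : 0 ≤ (((P a).bind adv) true).toReal := ENNReal.toReal_nonneg
    have hq0 : 0 ≤ (((Q a).bind adv) true).toReal := ENNReal.toReal_nonneg
    constructor <;> linarith
  · intro a _ ha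
    simp [h a ha]

end Uniform

/-! ### Shuffling lists -/

section Shuffle

variable {β γ : Type}

/-- A uniformly random rearrangement of a list. -/
noncomputable def shuffle (l : List β) : PMF (List β) :=
  (PMF.uniformOfFintype (Equiv.Perm (Fin l.length))).map fun σ => List.ofFn fun s => l.get (σ s)

theorem shuffle_eq_of_length {l : List β} {m : ℕ} (h : l.length = m) :
    shuffle l = (PMF.uniformOfFintype (Equiv.Perm (Fin m))).map
      fun σ => List.ofFn fun s => l.get ((σ s).cast h.symm) := by
  subst h
  rfl

theorem shuffle_map (f : β → γ) (l : List β) :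
    shuffle (l.map f) = (shuffle l).map (List.map f) := by
  rw [shuffle_eq_of_length (List.length_map f), shuffle, PMF.map_comp]
  congr 1
  funext σ
  simp [List.map_ofFn, Function.comp_def]

/-- Since entries are distinct, matching equal entries is a bijection of positions, and left
multiplication by it preserves the uniform law on permutations. -/
theorem shuffle_eq_of_perm {l l' : List β} (hl : l.Nodup) (h : l.Perm l') :
    shuffle l = shuffle l' := by
  classical
  have hl' : l'.Nodup := h.nodup_iff.1 hl
  let e : Fin l.length ≃ Fin l'.length :=
    (hl.getEquiv l).trans ((Equiv.subtypeEquivRight fun x => h.mem_iff).trans (hl'.getEquiv l').symm)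
  have he : ∀ i, l'.get (e i) = l.get i := by
    intro i
    have : (hl'.getEquiv l') (e i) = ⟨l.get i, h.mem_iff.1 (List.get_mem l i)⟩ := by
      simp only [e, Equiv.trans_apply, Equiv.apply_symm_apply]
      rfl
    simpa using congrArg Subtype.val this
  have hlen := h.length_eq
  let τ : Equiv.Perm (Fin l'.length) := (finCongr hlen).symm.trans e
  rw [shuffle_eq_of_length hlen, shuffle]
  conv_rhs => rw [← uniform_map_equiv (Equiv.mulLeft τ), PMF.map_comp]
  congr 1
  funext σ
  refine congrArg List.ofFn (funext fun s => ?_)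
  exact (he _).symm

/-- Shuffle the lists `ls 0, …, ls (m - 1)` independently and concatenate them. -/
noncomputable def concatShuffle (ls : ℕ → List β) : ℕ → PMF (List β)
  | 0 => PMF.pure []
  | m + 1 => (concatShuffle ls m).bind fun acc => (shuffle (ls m)).map fun l => acc ++ l

theorem concatShuffle_map (f : β → γ) (ls : ℕ → List β) (m : ℕ) :
    concatShuffle (fun b => (ls b).map f) m = (concatShuffle ls m).map (List.map f) := by
  induction m with
  | zero => simp [concatShuffle, PMF.pure_map]
  | succ m ih =>
    simp only [concatShuffle, ih, shuffle_map, PMF.bind_map, PMF.map_bind, PMF.map_comp]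
    congr 1
    funext acc
    simp [Function.comp_def]

/-- Shuffling erases the order inside a list. This absorbs both the order in which the network fills
a bin and the reordering caused by relabelling the elements. -/
theorem concatShuffle_congr {ls ls' : ℕ → List β} {m : ℕ} (hn : ∀ b < m, (ls b).Nodup)
    (h : ∀ b < m, (ls b).Perm (ls' b)) : concatShuffle ls m = concatShuffle ls' m := by
  induction m with
  | zero => rfl
  | succ m ih =>
    simp only [concatShuffle]
    rw [ih (fun b hb => hn b (by omega)) (fun b hb => h b (by omega)),
      shuffle_eq_of_perm (hn m (by omega)) (h m (by omega))]

theorem perm_of_mem_support_concatShuffle {ls : ℕ → List β} {m : ℕ} {l : List β}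
    (h : l ∈ (concatShuffle ls m).support) : l.Perm ((List.range m).flatMap ls) := by
  induction m generalizing l with
  | zero =>
    simp only [concatShuffle, PMF.mem_support_pure_iff] at h
    simp [h]
  | succ m ih =>
    simp only [concatShuffle, PMF.mem_support_bind_iff, PMF.mem_support_map_iff, shuffle] at h
    obtain ⟨acc, hacc, _, ⟨σ, _, rfl⟩, rfl⟩ := h
    rw [List.range_succ, List.flatMap_append]
    refine (ih hacc).append ?_
    have := Equiv.Perm.ofFn_comp_perm σ (ls m).get
    simpa [Function.comp_def] using this

/-- Links the simultaneous draw of all bin permutations to the bin-by-bin draw made by the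
algorithm: `Fin.snocEquiv` splits off the last permutation. -/
theorem uniform_perms_map_flatMap (ls : ℕ → List β) (m : ℕ) :
    ((PMF.uniformOfFintype ((b : Fin m) → Equiv.Perm (Fin (ls b).length))).map
      fun σ : (b : Fin m) → Equiv.Perm (Fin (ls b).length) =>
      (List.finRange m).flatMap fun b : Fin m => List.ofFn fun s => (ls b).get (σ b s)) =
    concatShuffle ls m := by
  induction m with
  | zero => exact PMF.map_const _ _
  | succ m ih =>
    rw [← uniform_map_equiv (Fin.snocEquiv fun b : Fin (m + 1) =>
      Equiv.Perm (Fin (ls b).length)), PMF.map_comp, ← PMF.bind_pure_comp, uniform_prod_bind,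
      PMF.bind_comm, concatShuffle, ← ih, PMF.bind_map]
    congr 1
    funext σ
    simp only [Function.comp_def, shuffle, PMF.map_comp]
    rw [← PMF.bind_pure_comp]
    refine congrArg (PMF.bind _) ?_
    funext τ
    simp [List.finRange_succ_last, Fin.snocEquiv, List.flatMap_map]

end Shuffle

theorem bind_congr_support {A C : Type} (p : PMF A) {f g : A → PMF C}
    (h : ∀ a ∈ p.support, f a = g a) : p.bind f = p.bind g := by
  ext c
  rw [PMF.bind_apply, PMF.bind_apply]
  refine tsum_congr fun a => ?_
  by_cases ha : p a = 0
  · simp [ha]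
  · rw [h a ((PMF.mem_support_iff _ _).2 ha)]

/-! ### Permutations from bins -/

section Bins

variable {n B : ℕ}

/-- The elements in the bin with number `b`. -/
def binNat (key : Fin n → Fin B) (b : ℕ) : List (Fin n) :=
  (List.finRange n).filter fun t => (key t : ℕ) = b

theorem binNat_coe (key : Fin n → Fin B) (b : Fin B) : binNat key b = bin key b := by
  simp [binNat, bin, Fin.ext_iff]

theorem nodup_binNat (key : Fin n → Fin B) (b : ℕ) : (binNat key b).Nodup :=
  (List.nodup_finRange n).filter _

theorem mem_binNat {key : Fin n → Fin B} {b : ℕ} {t : Fin n} :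
    t ∈ binNat key b ↔ (key t : ℕ) = b := by simp [binNat]

theorem perm_flatMap_binNat (key : Fin n → Fin B) :
    ((List.range B).flatMap (binNat key)).Perm (List.finRange n) := by
  refine (List.perm_ext_iff_of_nodup ?_ (List.nodup_finRange n)).2 ?_
  · rw [List.nodup_flatMap]
    refine ⟨fun b _ => nodup_binNat key b, ?_⟩
    refine List.nodup_range.imp fun {a b} hab t hta htb => hab ?_
    rw [mem_binNat] at hta htb
    omega
  · intro t
    simp only [List.mem_flatMap, List.mem_range, mem_binNat, List.mem_finRange, iff_true]
    exact ⟨key t, (key t).2, rfl⟩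

theorem loads_eq_card (key : Fin n → Fin B) (b : Fin B) :
    loads key b = Fintype.card {t // key t = b} := by
  rw [Fintype.card_subtype, loads, bin, ← List.toFinset_card_of_nodup]
  · congr 1
    ext t
    simp
  · exact (List.nodup_finRange n).filter _

theorem loads_comp (key : Fin n → Fin B) (τ : Equiv.Perm (Fin n)) :
    loads (key ∘ τ) = loads key := by
  funext b
  rw [loads_eq_card, loads_eq_card]
  exact Fintype.card_congr (τ.subtypeEquiv fun t => Iff.rfl)

/-- Only a permutation of lists: the left side lists the bin in increasing order, while `τ` need not
be monotone. -/
theorem binNat_comp_perm (key : Fin n → Fin B) (τ : Equiv.Perm (Fin n)) (b : ℕ) :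
    (binNat (key ∘ τ.symm) b).Perm ((binNat key b).map τ) := by
  refine (List.perm_ext_iff_of_nodup (nodup_binNat _ _)
    ((nodup_binNat _ _).map τ.injective)).2 fun t => ?_
  simp only [mem_binNat, List.mem_map, Function.comp_apply]
  constructor
  · intro h
    exact ⟨τ.symm t, h, by simp⟩
  · rintro ⟨s, h, rfl⟩
    simpa using h


theorem binShuffle_eq_concatShuffle [NeZero B] : binShuffle n B =
    (PMF.uniformOfFintype (Fin n → Fin B)).bind fun key =>
      (concatShuffle (binNat key) B).map fun l => (loads key, l) := by
  unfold binShuffle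
  congr 1
  funext key
  -- The type of `σ` depends on the lists, so they are generalized before `bin` is exchanged for
  -- `binNat`.
  have key_eq : ∀ ls : Fin B → List (Fin n), ls = (fun b : Fin B => binNat key b) →
      ((PMF.uniformOfFintype ((b : Fin B) → Equiv.Perm (Fin (ls b).length))).map
        fun σ : (b : Fin B) → Equiv.Perm (Fin (ls b).length) =>
        (loads key, (List.finRange B).flatMap fun b => List.ofFn fun s => (ls b).get (σ b s))) =
      (concatShuffle (binNat key) B).map fun l => (loads key, l) := by
    rintro ls rfl
    rw [← uniform_perms_map_flatMap, PMF.map_comp]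
    rfl
  exact key_eq (bin key) (funext fun b => (binNat_coe key b).symm)

theorem exists_ofFn_of_perm_finRange {l : List (Fin n)} (h : l.Perm (List.finRange n)) :
    ∃ π : Equiv.Perm (Fin n), l = List.ofFn π := by
  have hlen : l.length = n := by simpa using h.length_eq
  have hn : l.Nodup := h.nodup_iff.2 (List.nodup_finRange n)
  have hinj : Function.Injective fun s : Fin n => l.get (s.cast hlen.symm) := fun s t hst => by
    have := List.nodup_iff_injective_get.1 hn hst
    simpa [Fin.ext_iff] using this
  refine ⟨Equiv.ofBijective _ (Finite.injective_iff_bijective.1 hinj), ?_⟩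
  apply List.ext_get
  · simp [hlen]
  · intro i h₁ h₂
    simp

/-- The permutation produced by shuffled bins is uniform and independent of the keys' loads. -/
theorem binShuffle_eq_uniform [NeZero B] : binShuffle n B =
    (PMF.uniformOfFintype (Fin n → Fin B)).bind fun key =>
      (PMF.uniformOfFintype (Equiv.Perm (Fin n))).map fun π : Equiv.Perm (Fin n) =>
        (loads key, List.ofFn π) := by
  -- Substituting `key ∘ τ⁻¹` for the uniform `key` keeps the loads and applies `τ` to every entry
  -- of the arrangement.
  have relabel : ∀ τ : Equiv.Perm (Fin n), binShuffle n B =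
      (PMF.uniformOfFintype (Fin n → Fin B)).bind fun key =>
        (concatShuffle (binNat key) B).bind fun l => PMF.pure (loads key, l.map τ) := by
    intro τ
    rw [binShuffle_eq_concatShuffle, ← uniform_bind_equiv (τ.arrowCongr (Equiv.refl (Fin B)))]
    congr 1
    funext key
    have hk : (τ.arrowCongr (Equiv.refl (Fin B))) key = key ∘ τ.symm := rfl
    rw [hk, loads_comp, concatShuffle_congr (fun b _ => nodup_binNat _ b)
      (fun b _ => binNat_comp_perm key τ b), concatShuffle_map, PMF.map_comp]
    rfl
  -- A uniform `τ` is introduced. For each fixed arrangement `π` the composite `τ * π` is again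
  -- uniform, so the draw of `π` no longer matters.
  rw [← PMF.bind_const (PMF.uniformOfFintype (Equiv.Perm (Fin n))) (binShuffle n B),
    congrArg (PMF.bind _) (funext relabel), PMF.bind_comm]
  refine congrArg (PMF.bind _) (funext fun key => ?_)
  rw [PMF.bind_comm]
  refine (bind_congr_support _ fun l hl => ?_).trans (PMF.bind_const (concatShuffle (binNat key) B) _)
  obtain ⟨π, rfl⟩ := exists_ofFn_of_perm_finRange
    ((perm_of_mem_support_concatShuffle hl).trans (perm_flatMap_binNat key))
  conv_rhs => rw [← PMF.bind_pure_comp, ← uniform_bind_equiv (Equiv.mulRight π)]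
  refine congrArg (PMF.bind _) (funext fun τ => ?_)
  simp only [List.map_ofFn, Function.comp_apply, Equiv.coe_mulRight, Equiv.Perm.coe_mul]

theorem binShuffle_eq_randomLoads_bind [NeZero B] : binShuffle n B =
    (randomLoads n B).bind fun k =>
      (PMF.uniformOfFintype (Equiv.Perm (Fin n))).map fun π : Equiv.Perm (Fin n) => (k, List.ofFn π) := by
  rw [binShuffle_eq_uniform, randomLoads, PMF.bind_map]
  rfl

theorem binShuffle_apply [NeZero B] (k : Fin B → ℕ) (π : Equiv.Perm (Fin n)) :
    binShuffle n B (k, List.ofFn π) = randomLoads n B k * (n ! : ENNReal)⁻¹ := by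
  rw [binShuffle_eq_randomLoads_bind, PMF.bind_apply, tsum_eq_single k]
  · congr 1
    rw [PMF.map_apply, tsum_eq_single π]
    · simp [Fintype.card_perm]
    · intro τ hτ
      rw [if_neg]
      intro h
      exact hτ (Equiv.coe_fn_injective (List.ofFn_injective (Prod.ext_iff.1 h).2)).symm
  · intro k' hk'
    rw [PMF.map_apply, ENNReal.tsum_eq_zero.2, mul_zero]
    intro τ
    rw [if_neg]
    intro h
    exact hk' (Prod.ext_iff.1 h).1.symm

/-! ### Counting assignments with given loads -/

theorem exists_loads_eq (k : Fin B → ℕ) (hk : ∑ b, k b = n) :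
    ∃ key : Fin n → Fin B, loads key = k := by
  have e : Fin n ≃ Σ b : Fin B, Fin (k b) := Fintype.equivOfCardEq (by simp [hk])
  refine ⟨fun t => (e t).1, funext fun b => ?_⟩
  rw [loads_eq_card, Fintype.card_congr ((e.subtypeEquiv fun t => Iff.rfl).trans
    (Equiv.sigmaSubtype (β := fun b => Fin (k b)) b)), Fintype.card_fin]

/-- Permutations act on assignments by precomposition. Equal loads mean equinumerous fibres, and
bijections between fibres glue to a permutation. -/
theorem loads_eq_iff_mem_orbit (key₀ key : Fin n → Fin B) :
    loads key = loads key₀ ↔ key ∈ MulAction.orbit (Equiv.Perm (Fin n))ᵈᵐᵃ key₀ := by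
  constructor
  · intro h
    have e : ∀ b, {t // key t = b} ≃ {t // key₀ t = b} := fun b =>
      Fintype.equivOfCardEq (by rw [← loads_eq_card, ← loads_eq_card, h])
    refine ⟨DomMulAct.mk (Equiv.ofFiberEquiv e), funext fun t => ?_⟩
    exact Equiv.ofFiberEquiv_map e t
  · rintro ⟨g, rfl⟩
    exact loads_comp key₀ (DomMulAct.mk.symm g)

/-- Orbit-stabilizer: the assignments with loads `k` form one orbit, and the stabilizer of an
assignment is the product of the symmetric groups of its fibres. -/
theorem card_loads_mul (k : Fin B → ℕ) (hk : ∑ b, k b = n) :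
    Nat.card {key : Fin n → Fin B // loads key = k} * ∏ b, (k b)! = n ! := by
  obtain ⟨key₀, rfl⟩ := exists_loads_eq k hk
  have horbit : Nat.card {key : Fin n → Fin B // loads key = loads key₀} =
      Nat.card (MulAction.orbit (Equiv.Perm (Fin n))ᵈᵐᵃ key₀) :=
    Nat.card_congr (Equiv.subtypeEquivRight fun key => loads_eq_iff_mem_orbit key₀ key)
  have hstab : ∏ b, (loads key₀ b)! =
      Nat.card (MulAction.stabilizer (Equiv.Perm (Fin n))ᵈᵐᵃ key₀) := by
    simp_rw [loads_eq_card]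
    rw [← DomMulAct.stabilizer_card key₀, ← Nat.card_eq_fintype_card]
    exact Nat.card_congr (Equiv.subtypeEquiv DomMulAct.mk fun _ => Iff.rfl)
  rw [horbit, hstab, ← Nat.card_prod,
    Nat.card_congr (MulAction.orbitProdStabilizerEquivGroup _ key₀),
    ← Nat.card_congr (DomMulAct.mk (M := Equiv.Perm (Fin n))), Nat.card_perm, Nat.card_fin]

theorem card_loads_eq_multinomial (k : Fin B → ℕ) (hk : ∑ b, k b = n) :
    Nat.card {key : Fin n → Fin B // loads key = k} = Nat.multinomial Finset.univ k := by
  have h₁ := card_loads_mul k hk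
  have h₂ := Nat.multinomial_spec Finset.univ k
  rw [hk, mul_comm, ← h₁] at h₂
  exact (Nat.eq_of_mul_eq_mul_right (Finset.prod_pos fun b _ => Nat.factorial_pos _) h₂).symm

theorem mem_support_randomLoads [NeZero B] (k : Fin B → ℕ) (hk : ∑ b, k b = n) :
    k ∈ (randomLoads n B).support := by
  obtain ⟨key, hkey⟩ := exists_loads_eq k hk
  exact (PMF.mem_support_map_iff _ _ _).2 ⟨key, by simp, hkey⟩

end Bins

/-! ### Semantics of programs -/

namespace Prog

variable {Addr W β γ : Type} [DecidableEq Addr]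

/-- Continue an execution that has reached the outcome `r` with the program `f`. -/
noncomputable def resume (f : β → Prog Addr W γ) :
    List (Access Addr) × Option (β × (Addr → W)) →
      PMF (List (Access Addr) × Option (γ × (Addr → W)))
  | (T, none) => PMF.pure (T, none)
  | (T, some (b, mem)) => ((f b).run mem).map fun r => (T ++ r.1, r.2)

theorem resume_cons (f : β → Prog Addr W γ) (a : Access Addr)
    (r : List (Access Addr) × Option (β × (Addr → W))) :
    resume f (a :: r.1, r.2) = (resume f r).map fun r' => (a :: r'.1, r'.2) := by
  obtain ⟨T, _ | ⟨b, mem⟩⟩ := r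
  · simp [resume, PMF.pure_map]
  · simp only [resume, PMF.map_comp]
    rfl

theorem run_bind (p : Prog Addr W β) (f : β → Prog Addr W γ) (mem : Addr → W) :
    (p >>= f).run mem = (p.run mem).bind (resume f) := by
  change (p.bind f).run mem = _
  induction p generalizing mem with
  | ret b =>
    simp only [Prog.bind, run, PMF.pure_bind, resume, List.nil_append]
    exact (PMF.map_id _).symm
  | read a next ih =>
    simp only [Prog.bind, run, ih, PMF.bind_map, PMF.map_bind]
    exact congrArg (PMF.bind _) (funext fun r => (resume_cons f _ r).symm)
  | write a w next ih =>
    simp only [Prog.bind, run, ih, PMF.bind_map, PMF.map_bind]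
    exact congrArg (PMF.bind _) (funext fun r => (resume_cons f _ r).symm)
  | rand δ next ih => simp only [Prog.bind, run, ih, PMF.bind_bind]
  | abort => simp [Prog.bind, run, resume]

theorem run_pure (b : β) (mem : Addr → W) :
    (pure b : Prog Addr W β).run mem = PMF.pure ([], some (b, mem)) := rfl

/-- The program `p` started in `mem` has the access pattern `T`, the result `b` and the final memory
`mem'` with certainty. -/
def Runs (p : Prog Addr W β) (mem : Addr → W) (T : List (Access Addr)) (b : β)
    (mem' : Addr → W) : Prop :=
  p.run mem = PMF.pure (T, some (b, mem'))

theorem Runs.run_bind {p : Prog Addr W β} {mem mem' : Addr → W} {T : List (Access Addr)} {b : β}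
    (hp : Runs p mem T b mem') (f : β → Prog Addr W γ) :
    (p >>= f).run mem = ((f b).run mem').map fun r => (T ++ r.1, r.2) := by
  rw [Prog.run_bind, hp, PMF.pure_bind, resume]

theorem Runs.bind {p : Prog Addr W β} {f : β → Prog Addr W γ} {mem mem' mem'' : Addr → W}
    {T T' : List (Access Addr)} {b : β} {c : γ} (hp : Runs p mem T b mem')
    (hf : Runs (f b) mem' T' c mem'') : Runs (p >>= f) mem (T ++ T') c mem'' := by
  rw [Runs, hp.run_bind, hf, PMF.pure_map]

theorem runs_pure (b : β) (mem : Addr → W) : Runs (pure b : Prog Addr W β) mem [] b mem := rfl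

theorem runs_get (a : Addr) (mem : Addr → W) :
    Runs (get a : Prog Addr W W) mem [Access.read a] (mem a) mem := by
  simp [Runs, get, run, PMF.pure_map]

theorem runs_put (a : Addr) (w : W) (mem : Addr → W) :
    Runs (put a w) mem [Access.write a] () (Function.update mem a w) := by
  simp [Runs, put, run, PMF.pure_map]

theorem runs_collect {m : ℕ} {f : ℕ → Prog Addr W β} {τ : ℕ → List (Access Addr)} {v : ℕ → β}
    {mem : Addr → W} (h : ∀ s < m, Runs (f s) mem (τ s) (v s) mem) :
    Runs (collect m f) mem ((List.range m).flatMap τ) ((List.range m).map v) mem := by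
  induction m with
  | zero => exact runs_pure _ _
  | succ m ih =>
    have := (ih fun s hs => h s (by omega)).bind (f := fun l => do
      let b ← f m
      pure (l ++ [b])) ((h m (by omega)).bind (runs_pure _ _))
    rw [List.range_succ, List.flatMap_append, List.map_append]
    simp only [List.append_nil, List.flatMap_cons, List.flatMap_nil, List.map_cons, List.map_nil]
      at this ⊢
    exact this

/-- The trace `τ j` of an iteration may not depend on the memory, whereas the memory is only known
through `Inv`. This is how obliviousness is propagated through loops. -/
theorem runs_forRange {m : ℕ} {f : ℕ → Prog Addr W Unit} {τ : ℕ → List (Access Addr)}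
    (Inv : ℕ → (Addr → W) → Prop) {mem : Addr → W} (h₀ : Inv 0 mem)
    (h : ∀ j < m, ∀ mem, Inv j mem → ∃ mem', Runs (f j) mem (τ j) () mem' ∧ Inv (j + 1) mem') :
    ∃ mem', Runs (forRange m f) mem ((List.range m).flatMap τ) () mem' ∧ Inv m mem' := by
  induction m with
  | zero => exact ⟨mem, runs_pure _ _, h₀⟩
  | succ m ih =>
    obtain ⟨mem₁, hr₁, hi₁⟩ := ih fun j hj => h j (by omega)
    obtain ⟨mem₂, hr₂, hi₂⟩ := h m (by omega) mem₁ hi₁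
    refine ⟨mem₂, ?_, hi₂⟩
    rw [List.range_succ, List.flatMap_append]
    simp only [List.append_nil, List.flatMap_cons, List.flatMap_nil]
    exact hr₁.bind (f := fun _ => f m) hr₂

/-- A loop whose iterations write to different cells. -/
theorem runs_forRange_update {m : ℕ} {f : ℕ → Prog Addr W Unit} {τ : ℕ → List (Access Addr)}
    {addr : ℕ → Addr} {w : ℕ → W} (P : (Addr → W) → Prop) {mem : Addr → W} (hmem : P mem)
    (hinj : Function.Injective addr)
    (hP : ∀ s < m, ∀ mem, P mem → P (Function.update mem (addr s) (w s)))
    (h : ∀ s < m, ∀ mem, P mem → Runs (f s) mem (τ s) () (Function.update mem (addr s) (w s))) :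
    ∃ mem', Runs (forRange m f) mem ((List.range m).flatMap τ) () mem' ∧
      (∀ s < m, mem' (addr s) = w s) ∧ ∀ a, (∀ s < m, a ≠ addr s) → mem' a = mem a := by
  obtain ⟨mem', hr, -, hi⟩ := runs_forRange (m := m) (f := f) (τ := τ) (mem := mem)
    (fun k mem' => P mem' ∧ (∀ s < k, mem' (addr s) = w s) ∧
      ∀ a, (∀ s < k, a ≠ addr s) → mem' a = mem a) ⟨hmem, by simp, by simp⟩ (by
    rintro j hj mem₁ ⟨h₁, h₂, h₃⟩
    refine ⟨_, h j hj mem₁ h₁, hP j hj _ h₁, fun s hs => ?_, fun a ha => ?_⟩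
    · rcases Nat.lt_succ_iff_lt_or_eq.1 hs with hs | rfl
      · rw [Function.update_of_ne (fun e => hs.ne (hinj e)), h₂ s hs]
      · simp
    · rw [Function.update_of_ne (ha j (by omega)), h₃ a fun s hs => ha s (by omega)])
  exact ⟨mem', hr, hi⟩

theorem runs_forRange_put (m : ℕ) {addr : ℕ → Addr} (hinj : Function.Injective addr) (w : ℕ → W)
    (mem : Addr → W) :
    ∃ mem', Runs (forRange m fun s => put (addr s) (w s)) mem
        ((List.range m).map fun s => Access.write (addr s)) () mem' ∧
      (∀ s < m, mem' (addr s) = w s) ∧ ∀ a, (∀ s < m, a ≠ addr s) → mem' a = mem a := by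
  rw [List.map_eq_flatMap]
  exact runs_forRange_update (fun _ => True) trivial hinj (fun _ _ _ _ => trivial)
    fun s _ mem _ => runs_put _ _ _

/-! ### Drawing the coins in advance -/

variable {ι κ : Type} [Fintype ι] [DecidableEq ι] [Fintype κ] [Nonempty κ]

/-- The program `p` is equivalent to drawing a uniform function `key : ι → κ` and then executing
`d key`, which only uses the values of `key` in `S`. -/
def Derandomizes (p : Prog Addr W β) (d : (ι → κ) → Prog Addr W β) (S : Set ι) : Prop :=
  (∀ mem, p.run mem = (PMF.uniformOfFintype (ι → κ)).bind fun key => (d key).run mem) ∧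
    ∀ key key', (∀ i ∈ S, key i = key' i) → d key = d key'

theorem Derandomizes.mono {p : Prog Addr W β} {d : (ι → κ) → Prog Addr W β} {S S' : Set ι}
    (h : Derandomizes p d S) (hS : S ⊆ S') : Derandomizes p d S' :=
  ⟨h.1, fun key key' hk => h.2 key key' fun i hi => hk i (hS hi)⟩

theorem derandomizes_const (p : Prog Addr W β) :
    Derandomizes (ι := ι) (κ := κ) p (fun _ => p) ∅ :=
  ⟨fun mem => by simp, fun _ _ _ => rfl⟩

theorem derandomizes_sample (i : ι) :
    Derandomizes (sample κ : Prog Addr W κ) (fun key : ι → κ => pure (key i)) {i} :=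
  ⟨fun mem => (uniform_bind_eval i fun c : κ => (ret c : Prog Addr W κ).run mem).symm,
    fun _ _ h => congrArg pure (h i rfl)⟩

/-- Two independent key functions may be merged into one because the two programs consult disjoint
sets of keys; tracking `S` serves this purpose. -/
theorem Derandomizes.bind {p : Prog Addr W β} {d : (ι → κ) → Prog Addr W β} {S S' : Set ι}
    {f : β → Prog Addr W γ} {e : (ι → κ) → β → Prog Addr W γ} (hp : Derandomizes p d S)
    (hf : ∀ b, Derandomizes (f b) (fun key => e key b) S') (hS : Disjoint S S') :
    Derandomizes (p >>= f) (fun key => d key >>= e key) (S ∪ S') := by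
  refine ⟨fun mem => ?_, fun key key' h => ?_⟩
  · have hres : ∀ r, resume f r = (PMF.uniformOfFintype (ι → κ)).bind fun l => resume (e l) r := by
      rintro ⟨T, _ | ⟨b, mem⟩⟩
      · simp [resume]
      · simp only [resume, (hf b).1, PMF.map_bind]
    simp only [run_bind, hp.1, PMF.bind_bind]
    rw [← uniform_bind_diagonal S fun k l => ((d k).run mem).bind (resume (e l))]
    · refine congrArg (PMF.bind _) (funext fun k => ?_)
      rw [PMF.bind_comm]
      exact congrArg (PMF.bind _) (funext hres)
    · intro k k' l h
      rw [hp.2 k k' h]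
    · intro k l l' h
      have : e l = e l' := funext fun b =>
        (hf b).2 l l' fun i hi => h i fun hi' => Set.disjoint_left.1 hS hi' hi
      rw [this]
  · change d key >>= e key = d key' >>= e key'
    rw [hp.2 key key' fun i hi => h i (Or.inl hi)]
    exact congrArg _ (funext fun b => (hf b).2 key key' fun i hi => h i (Or.inr hi))

theorem derandomizes_forRange {m : ℕ} {f : ℕ → Prog Addr W Unit}
    {d : (ι → κ) → ℕ → Prog Addr W Unit} {S : ℕ → Set ι}
    (h : ∀ j < m, Derandomizes (f j) (fun key => d key j) (S j))
    (hS : ∀ j < m, ∀ j' < j, Disjoint (S j') (S j)) :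
    Derandomizes (forRange m f) (fun key => forRange m (d key)) {i | ∃ j < m, i ∈ S j} := by
  induction m with
  | zero => exact (derandomizes_const _).mono (Set.empty_subset _)
  | succ m ih =>
    refine ((ih (fun j hj => h j (by omega)) fun j hj => hS j (by omega)).bind
      (f := fun _ => f m) (fun _ => h m (by omega)) ?_).mono ?_
    · rw [Set.disjoint_left]
      rintro i ⟨j, hj, hi⟩ hi'
      exact Set.disjoint_left.1 (hS m (by omega) j hj) hi hi'
    · rintro i (⟨j, hj, hi⟩ | hi)
      · exact ⟨j, by omega, hi⟩
      · exact ⟨m, by omega, hi⟩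

end Prog

open Prog

/-! ### Buckets in the memory -/

section Buckets

variable {α : Type}

/-- In the memory `mem`, bucket `j` of level `i` contains the list `l`, padded with dummies. -/
def IsBucket (mem : Addr → Block α) (Z i j : ℕ) (l : List (Block α)) : Prop :=
  ∀ s < Z, mem (Addr.slot i j s) = l.getD s Block.dummy

theorem filter_isReal_padded {Z : ℕ} {l : List (Block α)} (hl : ∀ w ∈ l, w.isReal = true)
    (hZ : l.length ≤ Z) :
    (((List.range Z).map fun s => l.getD s Block.dummy).filter fun w => w.isReal) = l := by
  have : ((List.range Z).map fun s => l.getD s Block.dummy) =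
      l ++ List.replicate (Z - l.length) Block.dummy := by
    apply List.ext_getElem
    · simp [hZ]
    · intro s h₁ h₂
      by_cases hs : s < l.length
      · simp [hs]
      · rw [List.getElem_append_right (by omega)]
        simp [not_lt.1 hs]
  rw [this, List.filter_append, List.filter_eq_self.2 hl]
  simp [Block.isReal]

/-- The access pattern of reading a bucket. -/
def readTrace (Z i j : ℕ) : List (Access Addr) :=
  (List.range Z).flatMap fun s => [Access.read (Addr.slot i j s)]

/-- The access pattern of writing a bucket. -/
def writeTrace (Z i j : ℕ) : List (Access Addr) :=
  (List.range Z).map fun s => Access.write (Addr.slot i j s)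

theorem runs_readBucket (Z i j : ℕ) (mem : Addr → Block α) :
    Runs (readBucket Z i j) mem (readTrace Z i j)
      ((List.range Z).map fun s => mem (Addr.slot i j s)) mem :=
  runs_collect fun _ _ => runs_get _ _

theorem IsBucket.runs_readBucket {mem : Addr → Block α} {Z i j : ℕ} {l : List (Block α)}
    (h : IsBucket mem Z i j l) :
    Runs (readBucket Z i j) mem (readTrace Z i j)
      ((List.range Z).map fun s => l.getD s Block.dummy) mem := by
  have := BucketORP.runs_readBucket Z i j mem
  rwa [List.map_congr_left fun s hs => h s (List.mem_range.1 hs)] at this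

theorem runs_writeBucket (Z i j : ℕ) (l : List (Block α)) (mem : Addr → Block α) :
    ∃ mem', Runs (writeBucket Z i j l) mem (writeTrace Z i j) () mem' ∧ IsBucket mem' Z i j l ∧
      ∀ i' j' s, (i', j') ≠ (i, j) → mem' (Addr.slot i' j' s) = mem (Addr.slot i' j' s) := by
  obtain ⟨mem', hr, hw, hf⟩ := runs_forRange_put Z (addr := fun s => Addr.slot i j s)
    (fun s t h => by simpa using h) (fun s => l.getD s Block.dummy) mem
  refine ⟨mem', hr, hw, fun i' j' s h => hf _ fun t _ e => h ?_⟩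
  simp only [Addr.slot.injEq] at e
  rw [e.1, e.2.1]

theorem IsBucket.congr {mem mem' : Addr → Block α} {Z i j : ℕ} {l : List (Block α)}
    (h : IsBucket mem Z i j l) (hm : ∀ s, mem' (Addr.slot i j s) = mem (Addr.slot i j s)) :
    IsBucket mem' Z i j l := fun s hs => by rw [hm, h s hs]

end Buckets

/-! ### The contents of the buckets -/

section Contents

variable {α : Type} {n : ℕ}

/-- The element number `t` with its key. -/
def item (X : Fin n → α) {B : ℕ} (key : Fin n → Fin B) (t : Fin n) : Block α :=
  Block.keyed (key t) (X t)

/-- The elements with bit `e` of the key equal to `c`. -/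
def selectBit {B : ℕ} (key : Fin n → Fin B) (e : ℕ) (c : Bool) (l : List (Fin n)) : List (Fin n) :=
  l.filter fun t => (key t : ℕ).testBit e == c

/-- The access pattern of MergeSplit. -/
def mergeTrace (Z i j : ℕ) : List (Access Addr) :=
  readTrace Z i (j / 2 ^ i * 2 ^ i + j) ++ (readTrace Z i (j / 2 ^ i * 2 ^ i + j + 2 ^ i) ++
    (writeTrace Z (i + 1) (2 * j) ++ writeTrace Z (i + 1) (2 * j + 1)))

theorem runs_mergeSplit {Z i j B : ℕ} {X : Fin n → α} {key : Fin n → Fin B} {l₀ l₁ : List (Fin n)}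
    {mem : Addr → Block α}
    (hb₀ : IsBucket mem Z i (j / 2 ^ i * 2 ^ i + j) (l₀.map (item X key)))
    (hb₁ : IsBucket mem Z i (j / 2 ^ i * 2 ^ i + j + 2 ^ i) (l₁.map (item X key)))
    (hl₀ : l₀.length ≤ Z) (hl₁ : l₁.length ≤ Z)
    (hr : ∀ c, (selectBit key (levels n Z - 1 - i) c (l₀ ++ l₁)).length ≤ Z) :
    ∃ mem', Runs (mergeSplit n Z i j) mem (mergeTrace Z i j) () mem' ∧
      IsBucket mem' Z (i + 1) (2 * j)
        ((selectBit key (levels n Z - 1 - i) false (l₀ ++ l₁)).map (item X key)) ∧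
      IsBucket mem' Z (i + 1) (2 * j + 1)
        ((selectBit key (levels n Z - 1 - i) true (l₀ ++ l₁)).map (item X key)) ∧
      ∀ i' p s, (i', p) ≠ (i + 1, 2 * j) → (i', p) ≠ (i + 1, 2 * j + 1) →
        mem' (Addr.slot i' p s) = mem (Addr.slot i' p s) := by
  obtain ⟨mem₁, hw₁, hk₁, hf₁⟩ := runs_writeBucket Z (i + 1) (2 * j)
    ((selectBit key (levels n Z - 1 - i) false (l₀ ++ l₁)).map (item X key)) mem
  obtain ⟨mem₂, hw₂, hk₂, hf₂⟩ := runs_writeBucket Z (i + 1) (2 * j + 1)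
    ((selectBit key (levels n Z - 1 - i) true (l₀ ++ l₁)).map (item X key)) mem₁
  have hreal : ∀ l : List (Fin n), ∀ w ∈ l.map (item X key), w.isReal = true := by
    intro l w hw
    obtain ⟨t, -, rfl⟩ := List.mem_map.1 hw
    rfl
  refine ⟨mem₂, ?_, ?_, hk₂, ?_⟩
  · refine Runs.bind hb₀.runs_readBucket (Runs.bind hb₁.runs_readBucket ?_)
    rw [List.filter_append, filter_isReal_padded (hreal _) (by simpa using hl₀),
      filter_isReal_padded (hreal _) (by simpa using hl₁), ← List.map_append]
    have h₀ : ((l₀ ++ l₁).map (item X key)).filter (fun w => !w.keyBit (levels n Z - 1 - i)) =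
        (selectBit key (levels n Z - 1 - i) false (l₀ ++ l₁)).map (item X key) := by
      rw [List.filter_map, selectBit]
      congr 2
      funext t
      simp [item, Block.keyBit]
    have h₁ : ((l₀ ++ l₁).map (item X key)).filter (fun w => w.keyBit (levels n Z - 1 - i)) =
        (selectBit key (levels n Z - 1 - i) true (l₀ ++ l₁)).map (item X key) := by
      rw [List.filter_map, selectBit]
      congr 2
      funext t
      simp [item, Block.keyBit]
    simp only [h₀, h₁]
    rw [if_neg (by simpa using ⟨hr false, hr true⟩)]
    exact hw₁.bind (f := fun _ => writeBucket _ _ _ _) hw₂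
  · exact hk₁.congr fun s => hf₂ _ _ _ (by simp)
  · intro i' p s h h'
    rw [hf₂ _ _ _ h', hf₁ _ _ _ h]

theorem groupStart_mono (n Z : ℕ) : Monotone (groupStart n Z) := fun _ _ h =>
  Nat.div_le_div_right (Nat.mul_le_mul_right n h)

theorem groupStart_numBuckets (n Z : ℕ) : groupStart n Z (numBuckets n Z) = n :=
  Nat.mul_div_cancel_left n (by positivity)

/-- The elements of group `j`. -/
def groupList (n Z : ℕ) [NeZero n] (j : ℕ) : List (Fin n) :=
  (List.range (groupStart n Z (j + 1) - groupStart n Z j)).map fun s =>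
    Fin.ofNat n (groupStart n Z j + s)

/-- The elements in bucket `p` of level `i`, in the absence of overflows. -/
def levelList (n Z : ℕ) [NeZero n] {B : ℕ} (key : Fin n → Fin B) : ℕ → ℕ → List (Fin n)
  | 0, p => groupList n Z p
  | i + 1, p => selectBit key (levels n Z - 1 - i) (decide (p % 2 = 1))
      (levelList n Z key i (p / 2 / 2 ^ i * 2 ^ i + p / 2) ++
        levelList n Z key i (p / 2 / 2 ^ i * 2 ^ i + p / 2 + 2 ^ i))

/-- Does some bucket overflow? -/
def Overflow (n Z : ℕ) [NeZero n] (key : Fin n → Fin (numBuckets n Z)) : Prop :=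
  ∃ i < levels n Z, ∃ p < numBuckets n Z, Z < (levelList n Z key (i + 1) p).length

theorem two_mul_le_mul_numBuckets (n : ℕ) {Z : ℕ} (hZ : 0 < Z) : 2 * n ≤ Z * numBuckets n Z := by
  have h : (2 * n) ⌈/⌉ Z ≤ numBuckets n Z := Nat.le_pow_clog (by norm_num) _
  have := (ceilDiv_le_iff_le_mul hZ).1 h
  simpa [mul_comm] using this

/-- The integer `w` passes through the floor, so rounding costs nothing. Bounding an even number of
groups together gives `Z / 2` per group without halving `Z`. -/
theorem groupStart_add_le {n Z : ℕ} {c w : ℕ} (h : c * n ≤ w * numBuckets n Z) (j : ℕ) :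
    groupStart n Z (j + c) ≤ groupStart n Z j + w := by
  unfold groupStart
  rw [← Nat.add_mul_div_right _ _ (show 0 < numBuckets n Z by positivity)]
  exact Nat.div_le_div_right (by linarith [add_mul j c n])

theorem groupStart_succ_le {Z j : ℕ} (hj : j < numBuckets n Z) : groupStart n Z (j + 1) ≤ n :=
  (groupStart_mono n Z hj).trans (groupStart_numBuckets n Z).le

variable [NeZero n]

theorem length_groupList {Z : ℕ} (hZ : 0 < Z) (j : ℕ) : (groupList n Z j).length ≤ Z := by
  have := groupStart_add_le (n := n) (Z := Z) (c := 1) (w := Z)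
    (by linarith [two_mul_le_mul_numBuckets n hZ, Nat.zero_le n]) j
  simp only [groupList, List.length_map, List.length_range]
  omega

theorem mem_groupList {Z j : ℕ} (hj : j < numBuckets n Z) (t : Fin n) :
    t ∈ groupList n Z j ↔ groupStart n Z j ≤ t ∧ (t : ℕ) < groupStart n Z (j + 1) := by
  have hle := groupStart_succ_le hj
  simp only [groupList, List.mem_map, List.mem_range]
  constructor
  · rintro ⟨s, hs, rfl⟩
    rw [Fin.val_ofNat, Nat.mod_eq_of_lt (by omega)]
    omega
  · rintro ⟨h₁, h₂⟩
    refine ⟨t - groupStart n Z j, by omega, Fin.ext ?_⟩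
    rw [Fin.val_ofNat, Nat.mod_eq_of_lt (by omega)]
    omega

theorem nodup_groupList {Z j : ℕ} (hj : j < numBuckets n Z) : (groupList n Z j).Nodup := by
  have hle := groupStart_succ_le hj
  refine List.Nodup.map_on (fun s hs s' hs' h => ?_) List.nodup_range
  rw [List.mem_range] at hs hs'
  have := congrArg Fin.val h
  rw [Fin.val_ofNat, Fin.val_ofNat, Nat.mod_eq_of_lt (by omega), Nat.mod_eq_of_lt (by omega)] at this
  omega

end Contents

/-! ### Which elements reach a given bucket of the network -/

section Levels

variable {n Z : ℕ}

theorem half_numBuckets_mul_two (hL : 0 < levels n Z) : numBuckets n Z / 2 * 2 = numBuckets n Z :=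
  Nat.div_mul_cancel (dvd_pow_self 2 hL.ne')

/-- Both buckets that are read by MergeSplit exist. -/
theorem merge_index_lt {i j : ℕ} (hi : i < levels n Z) (hj : j < numBuckets n Z / 2) :
    j / 2 ^ i * 2 ^ i + j + 2 ^ i < numBuckets n Z := by
  have hB : numBuckets n Z = 2 ^ (levels n Z - 1 - i) * 2 ^ i * 2 := by
    rw [numBuckets, ← pow_add, ← pow_succ]
    congr 1
    omega
  rw [hB, Nat.mul_div_cancel _ two_pos] at hj
  have hq : j / 2 ^ i < 2 ^ (levels n Z - 1 - i) := (Nat.div_lt_iff_lt_mul (by positivity)).2 hj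
  have hr : j % 2 ^ i < 2 ^ i := Nat.mod_lt _ (by positivity)
  have hd := Nat.div_add_mod' j (2 ^ i)
  have := Nat.mul_le_mul_right (2 ^ i) hq
  rw [Nat.succ_mul] at this
  rw [hB]
  omega

theorem merge_index_div (i j : ℕ) : (j / 2 ^ i * 2 ^ i + j) / 2 ^ i = 2 * (j / 2 ^ i) := by
  rw [add_comm, Nat.add_mul_div_right _ _ (by positivity), two_mul]

theorem merge_index_mod (i j : ℕ) : (j / 2 ^ i * 2 ^ i + j) % 2 ^ i = j % 2 ^ i := by
  rw [add_comm, Nat.add_mul_mod_self_right]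

variable [NeZero n]

/-- The invariant of the butterfly network: the quotient `p / 2^i` names a block of `2^i`
consecutive groups, and the remainder `p % 2^i` spells the top `i` key bits. The two buckets read by
a MergeSplit belong to adjacent blocks and share the remainder; merging them doubles the block and
fixes one more bit. -/
theorem mem_levelList (key : Fin n → Fin (numBuckets n Z)) {i p : ℕ} (hi : i ≤ levels n Z)
    (hp : p < numBuckets n Z) (t : Fin n) :
    t ∈ levelList n Z key i p ↔
      (groupStart n Z (p / 2 ^ i * 2 ^ i) ≤ t ∧
        (t : ℕ) < groupStart n Z ((p / 2 ^ i + 1) * 2 ^ i)) ∧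
      (key t : ℕ) / 2 ^ (levels n Z - i) = p % 2 ^ i := by
  induction i generalizing p with
  | zero =>
    have := (key t).2
    simp only [levelList, mem_groupList hp, pow_zero, Nat.div_one, mul_one, Nat.mod_one, tsub_zero]
    rw [Nat.div_eq_of_lt this]
    simp
  | succ i ih =>
    have hj : p / 2 < numBuckets n Z / 2 := by
      have := half_numBuckets_mul_two (n := n) (Z := Z) (by omega)
      omega
    have hlt := merge_index_lt (i := i) (by omega) hj
    have hlo : 0 < 2 ^ i := by positivity
    rw [levelList, selectBit, List.mem_filter, List.mem_append, ih (by omega) (by omega),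
      ih (by omega) hlt, Nat.add_div_right _ hlo, Nat.add_mod_right, merge_index_div,
      merge_index_mod, Nat.testBit_eq_decide_div_mod_eq]
    have hpow : p / 2 ^ (i + 1) = p / 2 / 2 ^ i := by rw [pow_succ', Nat.div_div_eq_div_mul]
    have hk : (key t : ℕ) / 2 ^ (levels n Z - i) = (key t : ℕ) / 2 ^ (levels n Z - 1 - i) / 2 := by
      rw [Nat.div_div_eq_div_mul, ← pow_succ]
      congr 2
      omega
    have hm : p % 2 ^ (i + 1) / 2 = p / 2 % 2 ^ i := by
      rw [pow_succ', Nat.mod_mul_right_div_self]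
    have hm' : p % 2 ^ (i + 1) % 2 = p % 2 := by
      rw [pow_succ', Nat.mod_mul_right_mod]
    -- The parity of `p` is the newly tested bit, appended below the bits already fixed.
    have hbit : ((key t : ℕ) / 2 ^ (levels n Z - 1 - i) / 2 = p / 2 % 2 ^ i ∧
        (decide ((key t : ℕ) / 2 ^ (levels n Z - 1 - i) % 2 = 1) == decide (p % 2 = 1)) = true) ↔
        (key t : ℕ) / 2 ^ (levels n Z - (i + 1)) = p % 2 ^ (i + 1) := by
      rw [show levels n Z - (i + 1) = levels n Z - 1 - i by omega, ← hm, ← hm', beq_iff_eq,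
        decide_eq_decide]
      omega
    rw [← hbit, hk, hpow]
    have h₁ : groupStart n Z (2 * (p / 2 / 2 ^ i) * 2 ^ i) ≤
        groupStart n Z ((2 * (p / 2 / 2 ^ i) + 1) * 2 ^ i) :=
      groupStart_mono n Z (Nat.mul_le_mul_right _ (by omega))
    have h₂ : groupStart n Z ((2 * (p / 2 / 2 ^ i) + 1) * 2 ^ i) ≤
        groupStart n Z ((2 * (p / 2 / 2 ^ i) + 1 + 1) * 2 ^ i) :=
      groupStart_mono n Z (Nat.mul_le_mul_right _ (by omega))
    rw [show p / 2 / 2 ^ i * 2 ^ (i + 1) = 2 * (p / 2 / 2 ^ i) * 2 ^ i by ring,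
      show (p / 2 / 2 ^ i + 1) * 2 ^ (i + 1) = (2 * (p / 2 / 2 ^ i) + 1 + 1) * 2 ^ i by ring]
    constructor
    · rintro ⟨⟨h, h'⟩ | ⟨h, h'⟩, hb⟩
      · exact ⟨by omega, h', hb⟩
      · exact ⟨by omega, h', hb⟩
    · rintro ⟨h, h', hb⟩
      refine ⟨?_, hb⟩
      by_cases hc : (t : ℕ) < groupStart n Z ((2 * (p / 2 / 2 ^ i) + 1) * 2 ^ i)
      · exact Or.inl ⟨⟨h.1, hc⟩, h'⟩
      · exact Or.inr ⟨⟨by omega, h.2⟩, h'⟩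

/-- The two merged buckets draw from disjoint, adjacent ranges of positions. -/
theorem nodup_levelList (key : Fin n → Fin (numBuckets n Z)) {i p : ℕ} (hi : i ≤ levels n Z)
    (hp : p < numBuckets n Z) : (levelList n Z key i p).Nodup := by
  induction i generalizing p with
  | zero => exact nodup_groupList hp
  | succ i ih =>
    have hj : p / 2 < numBuckets n Z / 2 := by
      have := half_numBuckets_mul_two (n := n) (Z := Z) (by omega)
      omega
    have hlt := merge_index_lt (i := i) (by omega) hj
    have hlt' := (Nat.le_add_right _ _).trans_lt hlt
    refine List.Nodup.filter _ (List.Nodup.append (ih (by omega) hlt') (ih (by omega) hlt) ?_)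
    intro t h₀ h₁
    rw [mem_levelList key (by omega) hlt', merge_index_div] at h₀
    rw [mem_levelList key (by omega) hlt, Nat.add_div_right _ (by positivity),
      merge_index_div] at h₁
    have h₂ := h₀.1.2
    have h₃ := h₁.1.1
    omega

/-- At the last level the block of groups is the whole input and every key bit is fixed. -/
theorem levelList_perm_binNat (key : Fin n → Fin (numBuckets n Z)) {p : ℕ}
    (hp : p < numBuckets n Z) : (levelList n Z key (levels n Z) p).Perm (binNat key p) := by
  refine (List.perm_ext_iff_of_nodup (nodup_levelList key le_rfl hp) (nodup_binNat key p)).2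
    fun t => ?_
  rw [mem_levelList key le_rfl hp, mem_binNat, Nat.div_eq_of_lt hp, Nat.mod_eq_of_lt hp,
    Nat.sub_self, pow_zero, Nat.div_one, zero_mul, zero_add, one_mul, groupStart_numBuckets]
  simp [groupStart]

end Levels

/-! ### The bin assignment for given keys -/

section Assignment

variable {α : Type} {n Z : ℕ}

/-- The initialization of one slot of level `0` with given keys. -/
def initSlot (n Z : ℕ) [NeZero n] (key : Fin n → Fin (numBuckets n Z)) (j s : ℕ) :
    Prog Addr (Block α) Unit :=
  if groupStart n Z j + s < groupStart n Z (j + 1) then do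
    let w ← Prog.get (Addr.input (groupStart n Z j + s))
    let k ← pure (key (Fin.ofNat n (groupStart n Z j + s)))
    Prog.put (Addr.slot 0 j s) (w.withKey k)
  else
    Prog.put (Addr.slot 0 j s) Block.dummy

/-- The initialization of level `0` with given keys. -/
def initWithKeys (n Z : ℕ) [NeZero n] (key : Fin n → Fin (numBuckets n Z)) :
    Prog Addr (Block α) Unit :=
  Prog.forRange (numBuckets n Z) fun j => Prog.forRange Z fun s => initSlot n Z key j s

/-- The MergeSplit steps of all levels. -/
def mergeLevels (n Z : ℕ) : Prog Addr (Block α) Unit :=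
  Prog.forRange (levels n Z) fun i =>
    Prog.forRange (numBuckets n Z / 2) fun j => mergeSplit n Z i j

variable [NeZero n]

/-- Each position of the input lies in one group and one slot, so no element's key is drawn twice.
-/
theorem derandomizes_initBuckets : Derandomizes (initBuckets n Z : Prog Addr (Block α) Unit)
    (fun key : Fin n → Fin (numBuckets n Z) => initWithKeys n Z key) Set.univ := by
  have slot : ∀ j < numBuckets n Z, ∀ s, Derandomizes
      (if groupStart n Z j + s < groupStart n Z (j + 1) then do
        let w ← Prog.get (Addr.input (groupStart n Z j + s))
        let key ← Prog.sample (Fin (numBuckets n Z))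
        Prog.put (Addr.slot 0 j s) (w.withKey key)
      else Prog.put (Addr.slot 0 j s) (Block.dummy : Block α))
      (fun key : Fin n → Fin (numBuckets n Z) => initSlot n Z key j s)
      {t | (t : ℕ) = groupStart n Z j + s ∧ (t : ℕ) < groupStart n Z (j + 1)} := by
    intro j hj s
    have hle := groupStart_succ_le hj
    unfold initSlot
    by_cases h : groupStart n Z j + s < groupStart n Z (j + 1)
    · simp only [if_pos h]
      refine ((derandomizes_const _).bind (fun w => (derandomizes_sample
        (Fin.ofNat n (groupStart n Z j + s))).bind (S' := ∅) (fun k => derandomizes_const _)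
          (by simp)) (by simp)).mono ?_
      simp only [Set.empty_union, Set.union_empty, Set.singleton_subset_iff, Set.mem_ofPred_eq]
      rw [Fin.val_ofNat, Nat.mod_eq_of_lt (by omega)]
      exact ⟨rfl, h⟩
    · simp only [if_neg h]
      exact (derandomizes_const _).mono (Set.empty_subset _)
  refine (derandomizes_forRange (S := fun j => {t : Fin n | groupStart n Z j ≤ t ∧
    (t : ℕ) < groupStart n Z (j + 1)}) (fun j hj => ?_) ?_).mono (Set.subset_univ _)
  · refine (derandomizes_forRange (fun s _ => slot j hj s) ?_).mono ?_
    · intro s _ s' hs'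
      rw [Set.disjoint_left]
      rintro t ⟨h, -⟩ ⟨h', -⟩
      omega
    · rintro t ⟨s, -, h, h'⟩
      exact ⟨by omega, h'⟩
  · intro j _ j' hj'
    rw [Set.disjoint_left]
    rintro t ⟨-, h⟩ ⟨h', -⟩
    have := groupStart_mono n Z hj'
    simp only [Nat.succ_eq_add_one] at this
    omega

/-- The access pattern of the initialization of one slot. -/
def initSlotTrace (n Z j s : ℕ) : List (Access Addr) :=
  if groupStart n Z j + s < groupStart n Z (j + 1) then
    [Access.read (Addr.input (groupStart n Z j + s)), Access.write (Addr.slot 0 j s)]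
  else [Access.write (Addr.slot 0 j s)]

/-- The access pattern of the initialization. -/
def initTrace (n Z : ℕ) : List (Access Addr) :=
  (List.range (numBuckets n Z)).flatMap fun j => (List.range Z).flatMap (initSlotTrace n Z j)

theorem runs_initSlot (X : Fin n → α) (key : Fin n → Fin (numBuckets n Z)) {j : ℕ}
    (hj : j < numBuckets n Z) (s : ℕ) {mem : Addr → Block α}
    (hmem : ∀ t, mem (Addr.input t) = loadInput n X (Addr.input t)) :
    Runs (initSlot n Z key j s) mem (initSlotTrace n Z j s) () (Function.update mem
      (Addr.slot 0 j s) (((groupList n Z j).map (item X key)).getD s Block.dummy)) := by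
  have hle := groupStart_succ_le hj
  unfold initSlot initSlotTrace
  by_cases h : groupStart n Z j + s < groupStart n Z (j + 1)
  · simp only [if_pos h]
    have hs : s < groupStart n Z (j + 1) - groupStart n Z j := by omega
    have hn : groupStart n Z j + s < n := by omega
    have hw : ((groupList n Z j).map (item X key)).getD s Block.dummy =
        (mem (Addr.input (groupStart n Z j + s))).withKey
          (key (Fin.ofNat n (groupStart n Z j + s))) := by
      rw [hmem, List.getD_eq_getElem _ _ (by simpa [groupList] using hs)]
      simp only [groupList, List.map_map, List.getElem_map, List.getElem_range, Function.comp_apply,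
        item, loadInput, dif_pos hn, Block.withKey]
      exact congrArg _ (congrArg X (Fin.ext (Nat.mod_eq_of_lt hn)))
    rw [hw]
    exact (runs_get _ _).bind (runs_put _ _ _)
  · simp only [if_neg h]
    rw [List.getD_eq_default]
    · exact runs_put _ _ _
    · simp only [groupList, List.length_map, List.length_range]
      omega

theorem runs_initWithKeys (X : Fin n → α) (key : Fin n → Fin (numBuckets n Z)) :
    ∃ mem, Runs (initWithKeys n Z key) (loadInput n X) (initTrace n Z) () mem ∧
      ∀ j < numBuckets n Z, IsBucket mem Z 0 j ((groupList n Z j).map (item X key)) := by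
  obtain ⟨mem, hr, -, hb⟩ := runs_forRange (m := numBuckets n Z)
    (f := fun j => Prog.forRange Z fun s => initSlot n Z key j s)
    (τ := fun j => (List.range Z).flatMap (initSlotTrace n Z j))
    (fun k mem => (∀ t, mem (Addr.input t) = loadInput n X (Addr.input t)) ∧
      ∀ j < k, IsBucket mem Z 0 j ((groupList n Z j).map (item X key)))
    (mem := loadInput n X) ⟨fun _ => rfl, by simp⟩ (by
    rintro j hj mem ⟨hin, hb⟩
    obtain ⟨mem', hr, hw, hf⟩ := runs_forRange_update (m := Z)
      (addr := fun s => Addr.slot 0 j s) (mem := mem)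
      (fun mem => ∀ t, mem (Addr.input t) = loadInput n X (Addr.input t)) hin
      (fun s s' h => by simpa using h) (fun s _ mem h t => by simp [h])
      (fun s _ mem h => runs_initSlot X key hj s h)
    refine ⟨mem', hr, fun t => ?_, fun j' hj' => ?_⟩
    · rw [hf _ (by simp), hin]
    · rcases Nat.lt_succ_iff_lt_or_eq.1 hj' with hlt | rfl
      · exact (hb j' hlt).congr fun s => hf _ fun s' _ e => by
          simp only [Addr.slot.injEq] at e
          omega
      · exact hw)
  exact ⟨mem, hr, hb⟩

/-- The access pattern of the MergeSplit steps. -/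
def mergeLevelsTrace (n Z : ℕ) : List (Access Addr) :=
  (List.range (levels n Z)).flatMap fun i =>
    (List.range (numBuckets n Z / 2)).flatMap fun j => mergeTrace Z i j

theorem length_levelList (hZ : 0 < Z) {key : Fin n → Fin (numBuckets n Z)}
    (hov : ¬ Overflow n Z key) {i p : ℕ} (hi : i ≤ levels n Z) (hp : p < numBuckets n Z) :
    (levelList n Z key i p).length ≤ Z := by
  cases i with
  | zero => exact length_groupList hZ p
  | succ i =>
    by_contra h
    exact hov ⟨i, by omega, p, hp, by omega⟩

theorem levelList_two_mul (key : Fin n → Fin (numBuckets n Z)) (i j : ℕ) :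
    levelList n Z key (i + 1) (2 * j) = selectBit key (levels n Z - 1 - i) false
      (levelList n Z key i (j / 2 ^ i * 2 ^ i + j) ++
        levelList n Z key i (j / 2 ^ i * 2 ^ i + j + 2 ^ i)) := by
  rw [levelList, Nat.mul_div_cancel_left _ two_pos]
  simp

theorem levelList_two_mul_add_one (key : Fin n → Fin (numBuckets n Z)) (i j : ℕ) :
    levelList n Z key (i + 1) (2 * j + 1) = selectBit key (levels n Z - 1 - i) true
      (levelList n Z key i (j / 2 ^ i * 2 ^ i + j) ++
        levelList n Z key i (j / 2 ^ i * 2 ^ i + j + 2 ^ i)) := by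
  rw [levelList, show (2 * j + 1) / 2 = j by omega, show (2 * j + 1) % 2 = 1 by omega]
  simp

theorem runs_mergeLevels (hZ : 0 < Z) (X : Fin n → α) {key : Fin n → Fin (numBuckets n Z)}
    (hov : ¬ Overflow n Z key) {mem : Addr → Block α}
    (hmem : ∀ j < numBuckets n Z, IsBucket mem Z 0 j ((groupList n Z j).map (item X key))) :
    ∃ mem', Runs (mergeLevels n Z) mem (mergeLevelsTrace n Z) () mem' ∧
      ∀ p < numBuckets n Z,
        IsBucket mem' Z (levels n Z) p ((levelList n Z key (levels n Z) p).map (item X key)) := by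
  refine runs_forRange (fun i mem => ∀ p < numBuckets n Z,
    IsBucket mem Z i p ((levelList n Z key i p).map (item X key))) hmem ?_
  intro i hi mem hb
  have hhalf := half_numBuckets_mul_two (n := n) (Z := Z) (by omega)
  obtain ⟨mem', hr, -, hb'⟩ := runs_forRange (m := numBuckets n Z / 2)
    (f := fun j => mergeSplit n Z i j) (τ := fun j => mergeTrace Z i j)
    -- Level `i` stays intact while the first `k` calls fill the first `2 * k` buckets of level `i +
    -- 1`.
    (fun k mem => (∀ p < numBuckets n Z,
      IsBucket mem Z i p ((levelList n Z key i p).map (item X key))) ∧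
      ∀ p < 2 * k, IsBucket mem Z (i + 1) p ((levelList n Z key (i + 1) p).map (item X key)))
    (mem := mem) ⟨hb, by simp⟩ (by
    rintro j hj mem ⟨hold, hnew⟩
    have hlt := merge_index_lt hi hj
    have hlt' := (Nat.le_add_right _ _).trans_lt hlt
    obtain ⟨mem', hr, h₀, h₁, hf⟩ := runs_mergeSplit (hold _ hlt') (hold _ hlt)
      (length_levelList hZ hov hi.le hlt') (length_levelList hZ hov hi.le hlt) (by
        rintro (_ | _)
        · rw [← levelList_two_mul]
          exact length_levelList hZ hov hi (by omega)
        · rw [← levelList_two_mul_add_one]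
          exact length_levelList hZ hov hi (by omega))
    rw [← levelList_two_mul] at h₀
    rw [← levelList_two_mul_add_one] at h₁
    refine ⟨mem', hr, fun p hp => (hold p hp).congr fun s => hf _ _ _ (by simp) (by simp),
      fun p hp => ?_⟩
    rcases Nat.lt_or_ge p (2 * j) with h | h
    · exact (hnew p h).congr fun s => hf _ _ _
        (by simp only [ne_eq, Prod.mk.injEq]; omega) (by simp only [ne_eq, Prod.mk.injEq]; omega)
    · obtain rfl | rfl : p = 2 * j ∨ p = 2 * j + 1 := by omega
      · exact h₀
      · exact h₁)
  exact ⟨mem', hr, fun p hp => hb' p (by omega)⟩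

end Assignment

/-! ### Permuting the bins -/

section PermuteBins

variable {α : Type} {n Z : ℕ}

/-- The memory `mem` with the list `l` written to the beginning of the output array. -/
def writeOutput (mem : Addr → Block α) (l : List (Block α)) : Addr → Block α
  | Addr.output t => if t < l.length then l.getD t Block.dummy else mem (Addr.output t)
  | a => mem a

/-- Permute the list `real` in the client's storage and append it to the output array. -/
def appendShuffled (off : ℕ) (real : List (Block α)) : Prog Addr (Block α) ℕ := do
  let σ ← Prog.sample (Equiv.Perm (Fin real.length))
  let shuffled := List.ofFn fun s => (real.get (σ s)).dropKey
  Prog.forRange real.length fun s =>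
    Prog.put (Addr.output (off + s)) (shuffled.getD s Block.dummy)
  pure (off + real.length)

theorem permuteBins_succ (m : ℕ) :
    (permuteBins n Z (m + 1) : Prog Addr (Block α) ℕ) = permuteBins n Z m >>= fun off =>
      readBucket Z (levels n Z) m >>= fun w =>
        appendShuffled off (w.filter fun w => w.isReal) := rfl

/-- The access pattern of writing `k` elements to the output array from position `off` on. -/
def appendTrace (off k : ℕ) : List (Access Addr) :=
  (List.range k).map fun s => Access.write (Addr.output (off + s))

/-- The access pattern of `permuteBins` for the first `m` bins, when bin `b` has load `k b`. -/
def permuteTrace (n Z : ℕ) (k : ℕ → ℕ) : ℕ → List (Access Addr)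
  | 0 => []
  | m + 1 => permuteTrace n Z k m ++
      (readTrace Z (levels n Z) m ++ appendTrace (∑ b ∈ Finset.range m, k b) (k m))

theorem runs_append_output (mem : Addr → Block α) (acc l : List (Block α)) :
    Runs (Prog.forRange l.length fun s =>
        Prog.put (Addr.output (acc.length + s)) (l.getD s Block.dummy))
      (writeOutput mem acc) (appendTrace acc.length l.length) () (writeOutput mem (acc ++ l)) := by
  obtain ⟨mem', hr, hw, hf⟩ := runs_forRange_put l.length
    (addr := fun s => Addr.output (acc.length + s)) (fun s s' h => by simpa using h)
    (fun s => l.getD s Block.dummy) (writeOutput mem acc)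
  have : mem' = writeOutput mem (acc ++ l) := by
    funext a
    cases a with
    | input t => exact hf _ (by simp)
    | slot i j s => exact hf _ (by simp)
    | output t =>
      by_cases h : acc.length ≤ t ∧ t < acc.length + l.length
      · obtain ⟨s, rfl⟩ := Nat.exists_eq_add_of_le h.1
        rw [hw s (by omega)]
        simp only [writeOutput, List.length_append]
        rw [if_pos h.2, List.getD_append_right _ _ _ _ h.1, Nat.add_sub_cancel_left]
      · rw [hf _ fun s hs e => h (by simp only [Addr.output.injEq] at e; omega)]
        simp only [writeOutput, List.length_append]
        by_cases ht : t < acc.length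
        · rw [if_pos ht, if_pos (by omega), List.getD_append _ _ _ _ ht]
        · rw [if_neg ht, if_neg (by omega)]
  rwa [this] at hr

theorem run_appendShuffled (mem : Addr → Block α) (acc real : List (Block α)) :
    (appendShuffled acc.length real).run (writeOutput mem acc) =
      (shuffle (real.map Block.dropKey)).map fun l =>
        (appendTrace acc.length real.length,
          some ((acc ++ l).length, writeOutput mem (acc ++ l))) := by
  rw [shuffle_map, shuffle, PMF.map_comp, PMF.map_comp, ← PMF.bind_pure_comp]
  refine congrArg (PMF.bind _) (funext fun σ => ?_)
  have hlen : (List.ofFn fun s => (real.get (σ s)).dropKey).length = real.length := by simp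
  have h := runs_append_output mem acc (List.ofFn fun s => (real.get (σ s)).dropKey)
  rw [hlen] at h
  refine (h.bind (f := fun _ => pure (acc.length + real.length)) (runs_pure _ _)).trans ?_
  simp [List.map_ofFn, Function.comp_def]

theorem length_of_mem_support_concatShuffle {β : Type} {ls : ℕ → List β} {m : ℕ} {l : List β}
    (h : l ∈ (concatShuffle ls m).support) :
    l.length = ∑ b ∈ Finset.range m, (ls b).length := by
  rw [(perm_of_mem_support_concatShuffle h).length_eq, List.length_flatMap, Finset.sum_range]
  rw [← List.sum_ofFn, List.ofFn_eq_map, ← List.map_coe_finRange_eq_range, List.map_map]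
  rfl

/-- The write offset of a bin is the sum of the earlier loads, whatever the shuffles did. The trace
is therefore constant over the random choices, and only the output varies. -/
theorem run_permuteBins {mem : Addr → Block α} {ls : ℕ → List (Block α)} {m : ℕ}
    (hb : ∀ b < m, IsBucket mem Z (levels n Z) b (ls b)) (hlen : ∀ b < m, (ls b).length ≤ Z)
    (hreal : ∀ b < m, ∀ w ∈ ls b, w.isReal = true) :
    (permuteBins n Z m).run mem =
      (concatShuffle (fun b => (ls b).map Block.dropKey) m).map fun l =>
        (permuteTrace n Z (fun b => (ls b).length) m, some (l.length, writeOutput mem l)) := by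
  induction m with
  | zero =>
    have : writeOutput mem [] = mem := by
      funext a
      cases a <;> simp [writeOutput]
    simp [permuteBins, concatShuffle, PMF.pure_map, permuteTrace, this, run_pure]
  | succ m ih =>
    rw [permuteBins_succ, run_bind, ih (fun b hm => hb b (by omega)) (fun b hm => hlen b (by omega))
      (fun b hm => hreal b (by omega)), PMF.bind_map, concatShuffle, PMF.map_bind]
    refine bind_congr_support _ fun acc hacc => ?_
    -- Output writes leave the bucket slots untouched.
    have hbm : IsBucket (writeOutput mem acc) Z (levels n Z) m (ls m) :=
      (hb m (by omega)).congr fun s => rfl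
    simp only [Function.comp_apply, resume]
    rw [hbm.runs_readBucket.run_bind, filter_isReal_padded (hreal m (by omega)) (hlen m (by omega)),
      run_appendShuffled, PMF.map_comp, PMF.map_comp, PMF.map_comp,
      length_of_mem_support_concatShuffle hacc]
    simp [permuteTrace, Function.comp_def]

end PermuteBins

/-! ### The real and the ideal execution -/

section Execution

variable {α : Type} {n Z : ℕ}

/-- Bucket ORP with given keys. -/
def bucketORPWithKeys (n Z : ℕ) [NeZero n] (key : Fin n → Fin (numBuckets n Z)) :
    Prog Addr (Block α) Unit :=
  (initWithKeys n Z key >>= fun _ => mergeLevels n Z) >>= fun _ =>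
    permuteBins n Z (numBuckets n Z) >>= fun _ => pure ()

theorem derandomizes_bucketORP [NeZero n] :
    Derandomizes (bucketORP n Z : Prog Addr (Block α) Unit)
    (fun key : Fin n → Fin (numBuckets n Z) => bucketORPWithKeys n Z key) (Set.univ ∪ ∅ ∪ ∅) :=
  (derandomizes_initBuckets.bind (fun _ => derandomizes_const _) (by simp)).bind
    (fun _ => derandomizes_const _) (by simp)

/-- The access pattern of an execution without overflow in which the last bins have loads `k`. -/
def accessPattern (n Z : ℕ) (k : Fin (numBuckets n Z) → ℕ) : List (Access Addr) :=
  initTrace n Z ++ mergeLevelsTrace n Z ++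
    permuteTrace n Z (fun b => if h : b < numBuckets n Z then k ⟨b, h⟩ else 0) (numBuckets n Z)

/-- The output array that holds the elements in the order `l`. -/
def arrange (X : Fin n → α) (l : List (Fin n)) : Fin n → Block α :=
  fun t => (l.map fun s => Block.elem (X s)).getD t Block.dummy

theorem accessPattern_loads (key : Fin n → Fin (numBuckets n Z)) :
    accessPattern n Z (loads key) = initTrace n Z ++ mergeLevelsTrace n Z ++
      permuteTrace n Z (fun b => (binNat key b).length) (numBuckets n Z) := by
  unfold accessPattern
  congr 2
  funext b
  by_cases h : b < numBuckets n Z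
  · rw [dif_pos h, loads, ← binNat_coe]
  · rw [dif_neg h, eq_comm, List.length_eq_zero_iff, List.eq_nil_iff_forall_not_mem]
    intro t ht
    exact h (mem_binNat.1 ht ▸ (key t).2)

theorem permuteTrace_congr {k k' : ℕ → ℕ} {m : ℕ} (h : ∀ b < m, k b = k' b) :
    permuteTrace n Z k m = permuteTrace n Z k' m := by
  induction m with
  | zero => rfl
  | succ m ih =>
    rw [permuteTrace, permuteTrace, ih fun b hb => h b (by omega), h m (by omega),
      Finset.sum_congr rfl fun b hb => h b (by have := Finset.mem_range.1 hb; omega)]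

theorem readOutput_writeOutput (mem : Addr → Block α) (X : Fin n → α) {l : List (Fin n)}
    (h : l.length = n) :
    readOutput n (writeOutput mem (l.map fun s => Block.elem (X s))) = arrange X l := by
  funext t
  simp [readOutput, writeOutput, arrange, h]

theorem run_bucketORPWithKeys [NeZero n] (hZ : 0 < Z) (X : Fin n → α)
    {key : Fin n → Fin (numBuckets n Z)}
    (hov : ¬ Overflow n Z key) :
    ((bucketORPWithKeys n Z key).run (loadInput n X)).map
        (fun r => (r.1, r.2.map fun s => readOutput n s.2)) =
      (concatShuffle (binNat key) (numBuckets n Z)).map fun l =>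
        (accessPattern n Z (loads key), some (arrange X l)) := by
  obtain ⟨mem₁, hr₁, hb₁⟩ := runs_initWithKeys X key
  obtain ⟨mem₂, hr₂, hb₂⟩ := runs_mergeLevels hZ X hov hb₁
  have hperm := fun p hp => levelList_perm_binNat (Z := Z) key (p := p) hp
  have hrun := run_permuteBins (n := n) hb₂
    (fun b hb => by simpa using length_levelList hZ hov le_rfl hb)
    (fun b _ w hw => by obtain ⟨t, -, rfl⟩ := List.mem_map.1 hw; rfl)
  have hcs : concatShuffle (fun b => ((levelList n Z key (levels n Z) b).map (item X key)).map
      Block.dropKey) (numBuckets n Z) = (concatShuffle (binNat key) (numBuckets n Z)).map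
        (List.map fun s => Block.elem (X s)) := by
    rw [← concatShuffle_congr (fun b hb => nodup_levelList key le_rfl hb) hperm,
      ← concatShuffle_map]
    simp only [List.map_map]
    rfl
  rw [bucketORPWithKeys, (hr₁.bind (f := fun _ => mergeLevels n Z) hr₂).run_bind, run_bind, hrun,
    hcs, permuteTrace_congr fun b hb => by rw [List.length_map, (hperm b hb).length_eq],
    PMF.map_comp, PMF.bind_map, PMF.map_bind, PMF.bind_map, accessPattern_loads,
    ← PMF.bind_pure_comp]
  refine bind_congr_support _ fun l hl => ?_
  have hlen : l.length = n := by
    rw [((perm_of_mem_support_concatShuffle hl).trans (perm_flatMap_binNat key)).length_eq,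
      List.length_finRange]
  simp only [Function.comp_apply, resume, run_pure, PMF.pure_map, Option.map_some,
    readOutput_writeOutput mem₂ X hlen, List.append_nil]

/-- The independence of permutation and loads is used backwards: the independent pair is replaced by
shuffled bins whose keys also produce the loads, which can be compared with the real run key by key.
-/
theorem ideal_eq (X : Fin n → α) :
    (((randomLoads n (numBuckets n Z)).map (accessPattern n Z)).bind fun t =>
      (permFunctionality n X).map fun y => (t, some y)) =
    (PMF.uniformOfFintype (Fin n → Fin (numBuckets n Z))).bind fun key =>
      (concatShuffle (binNat key) (numBuckets n Z)).map fun l =>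
        (accessPattern n Z (loads key), some (arrange X l)) := by
  have h := congrArg (PMF.map fun q : (Fin (numBuckets n Z) → ℕ) × List (Fin n) =>
    (accessPattern n Z q.1, some (arrange X q.2)))
    ((binShuffle_eq_randomLoads_bind (n := n) (B := numBuckets n Z)).symm.trans
      binShuffle_eq_concatShuffle)
  simp only [PMF.map_bind, PMF.map_comp, Function.comp_def] at h
  rw [← h, PMF.bind_map]
  refine congrArg (PMF.bind _) (funext fun k => ?_)
  simp only [Function.comp_apply, permFunctionality, PMF.map_comp]
  congr 1
  funext π
  simp only [Function.comp_apply, Prod.mk.injEq, Option.some.injEq, true_and]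
  funext t
  simp [arrange]

theorem obliviouslyImplements_of_overflow [NeZero n] (hZ : 0 < Z) [DecidablePred (Overflow n Z)] {ε : ℝ}
    (hε : ((Finset.univ.filter (Overflow n Z)).card : ℝ) /
      Fintype.card (Fin n → Fin (numBuckets n Z)) ≤ ε) (α : Type) :
    ObliviouslyImplements (bucketORP (α := α) n Z) (loadInput n) (readOutput n)
      (permFunctionality n) ((randomLoads n (numBuckets n Z)).map (accessPattern n Z)) ε := by
  intro X
  rw [ideal_eq, derandomizes_bucketORP.1, PMF.map_bind]
  refine statIndist_of_agree _ _ (Finset.univ.filter (Overflow n Z)) (fun key hkey => ?_) hε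
  rw [run_bucketORPWithKeys hZ X (by simpa using hkey)]

end Execution

/-! ### The probability of an overflow -/

section Probability

/-- Chernoff bound for the number of elements of `S` with keys in `D`. -/
theorem card_many_keys_le {n B : ℕ} [NeZero B] (S : Finset (Fin n)) (D : Finset (Fin B)) (Z : ℕ) :
    ((Finset.univ.filter fun key : Fin n → Fin B =>
        Z < (S.filter fun t => key t ∈ D).card).card : ℝ) ≤
      (B : ℝ) ^ n * (Real.exp (S.card * (D.card / B)) / 2 ^ (Z + 1)) := by
  classical
  have hB : (0 : ℝ) < B := by exact_mod_cast Nat.pos_of_ne_zero (NeZero.ne B)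
  have hpow : ∀ key : Fin n → Fin B, (2 : ℝ) ^ (S.filter fun t => key t ∈ D).card =
      ∏ t, if t ∈ S ∧ key t ∈ D then (2 : ℝ) else 1 := by
    intro key
    rw [Finset.prod_ite, Finset.prod_const, Finset.prod_const_one, mul_one]
    congr 2
    ext t
    simp
  -- The exponential moment with base 2 factorizes over the independent keys.
  have hsum : ∑ key : Fin n → Fin B, (2 : ℝ) ^ (S.filter fun t => key t ∈ D).card =
      ∏ t, ∑ c, if t ∈ S ∧ c ∈ D then (2 : ℝ) else 1 := by
    rw [Finset.prod_univ_sum, Fintype.piFinset_univ]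
    exact Finset.sum_congr rfl fun key _ => hpow key
  -- For `t ∈ S` the sum is `B + |D|`, bounded through `1 + x ≤ e^x`.
  have hfactor : ∀ t : Fin n, (∑ c : Fin B, if t ∈ S ∧ c ∈ D then (2 : ℝ) else 1) ≤
      B * Real.exp (if t ∈ S then (D.card : ℝ) / B else 0) := by
    intro t
    by_cases ht : t ∈ S
    · have : ∀ c : Fin B, (if t ∈ S ∧ c ∈ D then (2 : ℝ) else 1) = 1 + if c ∈ D then 1 else 0 := by
        intro c
        by_cases hc : c ∈ D <;> simp [ht, hc]
        norm_num
      simp only [this, Finset.sum_add_distrib, Finset.sum_ite_mem, Finset.univ_inter, if_pos ht]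
      simp only [Finset.sum_const, Finset.card_univ, Fintype.card_fin, nsmul_eq_mul, mul_one]
      have := mul_le_mul_of_nonneg_left (Real.add_one_le_exp ((D.card : ℝ) / B)) hB.le
      refine le_trans (le_of_eq ?_) this
      field_simp
      ring
    · simp [ht]
  -- Markov's inequality. The load is an integer exceeding `Z`, hence at least `Z + 1`, which gains
  -- a factor 2 needed in the final bound.
  have hmarkov : ((Finset.univ.filter fun key : Fin n → Fin B =>
      Z < (S.filter fun t => key t ∈ D).card).card : ℝ) * 2 ^ (Z + 1) ≤
      ∑ key : Fin n → Fin B, (2 : ℝ) ^ (S.filter fun t => key t ∈ D).card := by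
    rw [← nsmul_eq_mul]
    refine (Finset.card_nsmul_le_sum _ _ _ fun key hkey => ?_).trans
      (Finset.sum_le_sum_of_subset_of_nonneg (Finset.filter_subset _ _)
        fun _ _ _ => by positivity)
    exact pow_le_pow_right₀ (by norm_num) (Finset.mem_filter.1 hkey).2
  rw [← mul_div_assoc, le_div_iff₀ (by positivity)]
  refine hmarkov.trans ?_
  rw [hsum]
  refine (Finset.prod_le_prod (fun t _ => Finset.sum_nonneg fun c _ => by split_ifs <;> norm_num)
    fun t _ => hfactor t).trans (le_of_eq ?_)
  rw [Finset.prod_mul_distrib, ← Real.exp_sum, Finset.sum_ite_mem, Finset.univ_inter]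
  simp

/-! ### Bounds on bucket loads and the union bound -/

variable {n Z : ℕ}

/-- The positions whose elements can reach bucket `p` of level `i`. -/
def positions (n Z i p : ℕ) : Finset (Fin n) :=
  Finset.univ.filter fun t => groupStart n Z (p / 2 ^ i * 2 ^ i) ≤ t ∧
    (t : ℕ) < groupStart n Z ((p / 2 ^ i + 1) * 2 ^ i)

/-- The keys that lead to bucket `p` of level `i`. -/
def keysTo (n Z i p : ℕ) : Finset (Fin (numBuckets n Z)) :=
  Finset.univ.filter fun c => (c : ℕ) / 2 ^ (levels n Z - i) = p % 2 ^ i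

theorem card_positions_le (hZ : 0 < Z) (i p : ℕ) :
    (positions n Z (i + 1) p).card ≤ 2 ^ i * Z := by
  have h := groupStart_add_le (n := n) (Z := Z) (c := 2 ^ (i + 1)) (w := 2 ^ i * Z)
    (by
      have := Nat.mul_le_mul_left (2 ^ i) (two_mul_le_mul_numBuckets n hZ)
      rw [pow_succ]
      linarith) (p / 2 ^ (i + 1) * 2 ^ (i + 1))
  have hcard : (positions n Z (i + 1) p).card ≤
      (Finset.Ico (groupStart n Z (p / 2 ^ (i + 1) * 2 ^ (i + 1)))
        (groupStart n Z ((p / 2 ^ (i + 1) + 1) * 2 ^ (i + 1)))).card :=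
    Finset.card_le_card_of_injOn Fin.val (fun t ht => by simpa [positions] using ht)
      Fin.val_injective.injOn
  rw [Nat.card_Ico, add_mul, one_mul] at hcard
  omega

theorem card_keysTo_le (i p : ℕ) : (keysTo n Z i p).card ≤ 2 ^ (levels n Z - i) := by
  have hcard : (keysTo n Z i p).card ≤
      (Finset.Ico (p % 2 ^ i * 2 ^ (levels n Z - i))
        ((p % 2 ^ i + 1) * 2 ^ (levels n Z - i))).card := by
    refine Finset.card_le_card_of_injOn Fin.val (fun c hc => ?_) Fin.val_injective.injOn
    simp only [keysTo, Finset.coe_filter, Finset.mem_univ, true_and, Set.mem_ofPred_eq] at hc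
    have hpos : 0 < 2 ^ (levels n Z - i) := by positivity
    simp only [Finset.coe_Ico, Set.mem_Ico]
    exact ⟨(Nat.le_div_iff_mul_le hpos).1 hc.ge, (Nat.div_lt_iff_lt_mul hpos).1 (by omega)⟩
  rwa [Nat.card_Ico, add_mul, one_mul, Nat.add_sub_cancel_left] at hcard

/-- Minimality of the power of two: half of it lies below `2n/Z`. With a single bucket the truncated
exponent is 0, and the claim is `Z ≤ 2n`. -/
theorem two_pow_levels_sub_one_le (hZ : 0 < Z) (hnZ : Z ≤ 2 * n) :
    (2 : ℝ) ^ (levels n Z - 1) ≤ 2 * n / Z := by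
  rw [le_div_iff₀ (by exact_mod_cast hZ)]
  rcases Nat.lt_or_ge 1 ((2 * n) ⌈/⌉ Z) with h | h
  · have hlt := Nat.pow_pred_clog_lt_self (b := 2) (by norm_num) h
    have := mt (ceilDiv_le_iff_le_mul hZ).2 (not_le.2 hlt)
    rw [not_le, mul_comm] at this
    exact_mod_cast this.le
  · have h₀ : levels n Z = 0 := Nat.clog_of_right_le_one h 2
    rw [h₀]
    simp only [zero_tsub, pow_zero, one_mul]
    exact_mod_cast hnZ

variable [NeZero n]

theorem length_levelList_eq (key : Fin n → Fin (numBuckets n Z)) {i p : ℕ} (hi : i ≤ levels n Z)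
    (hp : p < numBuckets n Z) : (levelList n Z key i p).length =
      ((positions n Z i p).filter fun t => key t ∈ keysTo n Z i p).card := by
  rw [← List.toFinset_card_of_nodup (nodup_levelList key hi hp)]
  congr 1
  ext t
  simp [mem_levelList key hi hp, positions, keysTo]

theorem card_level_overflow_le (hZ : 0 < Z) {i p : ℕ} (hi : i < levels n Z)
    (hp : p < numBuckets n Z) :
    ((Finset.univ.filter fun key : Fin n → Fin (numBuckets n Z) =>
        Z < (levelList n Z key (i + 1) p).length).card : ℝ) ≤
      (numBuckets n Z : ℝ) ^ n * (Real.exp (Z / 2) / 2 ^ (Z + 1)) := by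
  simp only [fun key : Fin n → Fin (numBuckets n Z) =>
    length_levelList_eq key (show i + 1 ≤ levels n Z by omega) hp]
  refine (card_many_keys_le (positions n Z (i + 1) p) (keysTo n Z (i + 1) p) Z).trans ?_
  gcongr
  have h₁ : ((positions n Z (i + 1) p).card : ℝ) ≤ 2 ^ i * Z := by
    exact_mod_cast card_positions_le hZ i p
  have h₂ : ((keysTo n Z (i + 1) p).card : ℝ) ≤ 2 ^ (levels n Z - (i + 1)) := by
    exact_mod_cast card_keysTo_le (i + 1) p
  have hB : ((numBuckets n Z : ℕ) : ℝ) = 2 ^ (levels n Z - (i + 1)) * 2 ^ i * 2 := by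
    rw [numBuckets, Nat.cast_pow, Nat.cast_ofNat, ← pow_add, ← pow_succ]
    congr 1
    omega
  -- The mean load: number of feeding positions times the fraction of matching keys.
  calc ((positions n Z (i + 1) p).card : ℝ) *
        (((keysTo n Z (i + 1) p).card : ℝ) / (numBuckets n Z : ℕ))
      ≤ 2 ^ i * Z * (2 ^ (levels n Z - (i + 1)) / (numBuckets n Z : ℕ)) := by gcongr
    _ = Z / 2 := by
      rw [hB]
      field_simp

/-- A bucket of level 1 is fed by only two groups, with at most `Z` elements together. This removes
one level from the union bound, so that `log B - 1` and not `log B` is compared with `log₂(2n/Z)`.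
-/
theorem length_levelList_one_le (hZ : 0 < Z) (key : Fin n → Fin (numBuckets n Z)) {p : ℕ}
    (hL : 0 < levels n Z) (hp : p < numBuckets n Z) : (levelList n Z key 1 p).length ≤ Z := by
  rw [length_levelList_eq key hL hp]
  refine (Finset.card_filter_le _ _).trans ?_
  simpa using card_positions_le (n := n) hZ 0 p

theorem card_overflow_le (hZ : 0 < Z) [DecidablePred (Overflow n Z)] :
    ((Finset.univ.filter (Overflow n Z)).card : ℝ) ≤
      ((levels n Z - 1 : ℕ) : ℝ) * (numBuckets n Z : ℕ) *
        ((numBuckets n Z : ℝ) ^ n * (Real.exp (Z / 2) / 2 ^ (Z + 1))) := by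
  classical
  have hsub : Finset.univ.filter (Overflow n Z) ⊆
      (Finset.Ico 1 (levels n Z) ×ˢ Finset.range (numBuckets n Z)).biUnion fun q =>
        Finset.univ.filter fun key => Z < (levelList n Z key (q.1 + 1) q.2).length := by
    intro key hkey
    obtain ⟨i, hi, p, hp, h⟩ := (Finset.mem_filter.1 hkey).2
    have hi₀ : 1 ≤ i := by
      by_contra hlt
      obtain rfl : i = 0 := by omega
      exact absurd (length_levelList_one_le hZ key hi hp) (by simpa using h)
    simp only [Finset.mem_biUnion, Finset.mem_product, Finset.mem_Ico, Finset.mem_range,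
      Finset.mem_filter, Finset.mem_univ, true_and]
    exact ⟨(i, p), ⟨⟨hi₀, hi⟩, hp⟩, h⟩
  have hle := (Finset.card_le_card hsub).trans Finset.card_biUnion_le
  refine (Nat.cast_le.2 hle).trans ?_
  rw [Nat.cast_sum]
  refine (Finset.sum_le_card_nsmul _ _ ((numBuckets n Z : ℝ) ^ n *
    (Real.exp (Z / 2) / 2 ^ (Z + 1))) fun q hq => ?_).trans (le_of_eq ?_)
  · simp only [Finset.mem_product, Finset.mem_Ico, Finset.mem_range] at hq
    exact card_level_overflow_le hZ hq.1.2 hq.2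
  · rw [Finset.card_product, Nat.card_Ico, Finset.card_range, nsmul_eq_mul, Nat.cast_mul]

theorem overflow_probability_le (hZ : 0 < Z) (hnZ : Z ≤ 2 * n) [DecidablePred (Overflow n Z)] :
    ((Finset.univ.filter (Overflow n Z)).card : ℝ) /
      Fintype.card (Fin n → Fin (numBuckets n Z)) ≤ errorBound n Z := by
  have hB : (0 : ℝ) < (numBuckets n Z : ℕ) := by exact_mod_cast Nat.two_pow_pos _
  have hcard : ((Fintype.card (Fin n → Fin (numBuckets n Z)) : ℕ) : ℝ) =
      (numBuckets n Z : ℝ) ^ n := by simp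
  have hx := two_pow_levels_sub_one_le hZ hnZ
  have hlog : ((levels n Z - 1 : ℕ) : ℝ) ≤ Real.logb 2 (2 * n / Z) := by
    rw [Real.le_logb_iff_rpow_le (by norm_num) (lt_of_lt_of_le (by positivity) hx),
      Real.rpow_natCast]
    exact hx
  have hhalf : ((numBuckets n Z : ℕ) : ℝ) ≤ 2 * (2 * n / Z) := by
    refine le_trans ?_ (mul_le_mul_of_nonneg_left hx two_pos.le)
    rw [← pow_succ', numBuckets, Nat.cast_pow, Nat.cast_ofNat]
    exact pow_le_pow_right₀ (by norm_num) (by omega)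
  have hexp : Real.exp (Z / 2) / 2 ^ Z ≤ Real.exp (-(Z : ℝ) / 6) := by
    have h2 : (2 : ℝ) ^ Z = Real.exp (Z * Real.log 2) := by
      rw [Real.exp_nat_mul, Real.exp_log two_pos]
    rw [h2, ← Real.exp_sub]
    refine Real.exp_le_exp.2 ?_
    -- The inequality amounts to `log 2 ≥ 1/2 + 1/6 = 2/3`.
    nlinarith [Real.log_two_gt_d9, (Nat.cast_nonneg Z : (0 : ℝ) ≤ Z)]
  rw [hcard, div_le_iff₀ (by positivity)]
  refine (card_overflow_le hZ).trans ?_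
  -- The spare factor 2 in `2^(Z+1)` turns the number `B` of buckets into `B / 2 ≤ 2n/Z`.
  calc ((levels n Z - 1 : ℕ) : ℝ) * (numBuckets n Z : ℕ) *
        ((numBuckets n Z : ℝ) ^ n * (Real.exp (Z / 2) / 2 ^ (Z + 1)))
      = ((levels n Z - 1 : ℕ) : ℝ) * ((numBuckets n Z : ℕ) / 2) * (Real.exp (Z / 2) / 2 ^ Z) *
        (numBuckets n Z : ℝ) ^ n := by
        rw [pow_succ]
        field_simp
    _ ≤ Real.logb 2 (2 * n / Z) * (2 * n / Z) * Real.exp (-(Z : ℝ) / 6) *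
        (numBuckets n Z : ℝ) ^ n := by
        have h₁ : ((numBuckets n Z : ℕ) : ℝ) / 2 ≤ 2 * n / Z := by linarith
        have h₀ : 0 ≤ Real.logb 2 (2 * n / Z) := le_trans (Nat.cast_nonneg _) hlog
        gcongr
    _ = errorBound n Z * (numBuckets n Z : ℝ) ^ n := by
        rw [errorBound]
        ring

end Probability

end BucketORP

theorem lemma2 (n Z : ℕ) (hZ : 0 < Z) (hnZ : Z ≤ 2 * n) :
    -- Oblivious implementation; the simulator only uses random bin loads.
    (∃ pattern : (Fin (BucketORP.numBuckets n Z) → ℕ) →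
        List (BucketORP.Access BucketORP.Addr),
      ∀ α : Type,
        BucketORP.ObliviouslyImplements (BucketORP.bucketORP (α := α) n Z)
          (BucketORP.loadInput n) (BucketORP.readOutput n) (BucketORP.permFunctionality n)
          ((BucketORP.randomLoads n (BucketORP.numBuckets n Z)).map pattern)
          (BucketORP.errorBound n Z)) ∧
    -- Conditioned on any load vector, the permutation produced by the bins is uniform.
    (∀ k ∈ (BucketORP.randomLoads n (BucketORP.numBuckets n Z)).support,
      ∀ π : Equiv.Perm (Fin n),
        BucketORP.binShuffle n (BucketORP.numBuckets n Z) (k, List.ofFn π) /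
          BucketORP.randomLoads n (BucketORP.numBuckets n Z) k = 1 / (n ! : ENNReal)) ∧
    -- Every load vector occurs, and the number of ways to reach it, with orders inside the bins.
    (∀ k : Fin (BucketORP.numBuckets n Z) → ℕ, ∑ b, k b = n →
      k ∈ (BucketORP.randomLoads n (BucketORP.numBuckets n Z)).support ∧
      Nat.card {key : Fin n → Fin (BucketORP.numBuckets n Z) // BucketORP.loads key = k} =
        Nat.multinomial Finset.univ k ∧
      Nat.multinomial Finset.univ k * ∏ b, (k b)! = n !) := by
  classical
  have : NeZero n := ⟨by omega⟩
  refine ⟨⟨BucketORP.accessPattern n Z, BucketORP.obliviouslyImplements_of_overflow hZ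
    (BucketORP.overflow_probability_le hZ hnZ)⟩, fun k hk π => ?_, fun k hk => ?_⟩
  · rw [BucketORP.binShuffle_apply, mul_comm, one_div]
    exact ENNReal.mul_div_cancel_right ((PMF.mem_support_iff _ _).1 hk) (PMF.apply_ne_top _ _)
  · refine ⟨BucketORP.mem_support_randomLoads k hk, BucketORP.card_loads_eq_multinomial k hk, ?_⟩
    rw [← BucketORP.card_loads_eq_multinomial k hk, BucketORP.card_loads_mul k hk]
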